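/- Let $F$ be a field and let $A=\{a_1<\dots<a_n\}$ be a finite set of positive integers of order $n\ge 1$. A set composition of a finite set $B$ of positive integers is a tuple $P=(P_1,\dots,P_l)$ of mutually disjoint non-empty sets with union $B$; its length is $\ell(P)=l$, and $\Pi_B$ denotes the set of all set compositions of $B$. Let $F\Pi=\bigoplus_B F\Pi_B$ be the vector space with basis $\bigcup_B\Pi_B$, and define bilinear products on $F\Pi$ by $$P\wedge Q=(P_1\cap Q_1,\dots,P_1\cap Q_k,\;\dots\;,P_l\cap Q_1,\dots,P_l\cap Q_k)^{\#}\ \text{ if }\ \textstyle\bigcup P=\bigcup Q,\qquad P\wedge Q=0\ \text{ otherwise},$$ where $\#$ means that empty sets are deleted, and $$P\vee Q=(P_1,\dots,P_l,Q_1,\dots,Q_k)\ \text{ if }\ \textstyle\bigcup P\cap\bigcup Q=\emptyset,\qquad P\vee Q=0\ \text{ otherwise}.$$ Then $(F\Pi_A,\wedge)$ is a finite-dimensional algebra with identity $(A)$. For a module $M$, let $\mathrm{rad}\,M$ be the intersection of all maximal submodules of $M$. Put $\mathrm{rad}^{(0)}F\Pi_A=F\Pi_A$ and $\mathrm{rad}^{(k+1)}F\Pi_A=\mathrm{rad}\big(\mathrm{rad}^{(k)}F\Pi_A\big)$,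 where $F\Pi_A$ is regarded as a left module over itself; thus $\mathrm{rad}^{(1)}F\Pi_A=\mathrm{rad}\,F\Pi_A$ is the Jacobson radical. For $B\neq\emptyset$ let $e_B=\sum(-1)^{\ell(P)-1}P$, summed over all $P\in\Pi_B$ with $\min B\in P_1$. Put $e_{(Q_1,\dots,Q_k)}=e_{Q_1}\vee\dots\vee e_{Q_k}$, and extend $Q\mapsto e_Q$ linearly to $F\Pi$. Let $f\circ g=f\vee g-g\vee f$, and define $Q^\circ$ by $(B)^\circ=(B)$ and $(Q_1,\dots,Q_k)^\circ=Q_1\circ\big((Q_2,\dots,Q_k)^\circ\big)$ for $k>1$, where the factor $Q_1$ stands for the set composition $(Q_1)$. Write $(x_1,\dots,x_n)$ for $(\{x_1\},\dots,\{x_n\})$. Then the nilpotency index of $\mathrm{rad}\,F\Pi_A$, that is, the smallest $k$ such that $\mathrm{rad}^{(k)}F\Pi_A=0$, is equal to $|A|=n$. More precisely, $$\mathrm{rad}^{(n-1)}F\Pi_A=e_A\wedge F\Pi_A\wedge e_{(a_1,a_2,\dots,a_n)}=\big\langle\, e_{(x_1,\dots,x_n)^\circ}\;:\;(x_1,\dots,x_n)\in\Pi_A,\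 x_n=a_1\,\big\rangle_F$$ has dimension $(n-1)!$, while $\mathrm{rad}^{(n)}F\Pi_A=0$. -/

import Mathlib

noncomputable section

namespace SolomonTits

/-- A set composition over `α`: a finite sequence `(P₁, …, P_l)` of mutually disjoint non-empty
finite subsets of `α`. The type `SetComp α` is the set `Π` of the set compositions of all
finite subsets of `α` (the empty sequence is the unique set composition of `∅`). -/
@[ext]
structure SetComp (α : Type*) [LinearOrder α] where
  blocks : List (Finset α)
  nonempty : ∀ B ∈ blocks, B.Nonempty
  disjoint : blocks.Pairwise Disjoint

theorem filter_flatMap_filter {β : Type*} (L : List (Finset β)) (f : Finset β → List (Finset β))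
    (hf : ∀ B, ¬ B.Nonempty → ∀ C ∈ f B, ¬ C.Nonempty) :
    ((L.filter fun B => B.Nonempty).flatMap f).filter (fun B => B.Nonempty)
      = (L.flatMap f).filter (fun B => B.Nonempty) := by
  induction L with
  | nil => rfl
  | cons B L ih =>
    by_cases h : B.Nonempty
    · simp [h, List.filter_append, ih]
    · have : (f B).filter (fun B => B.Nonempty) = [] := by
        rw [List.filter_eq_nil_iff]
        simpa using hf B h
      simp [h, List.filter_append, ih, this]

section Combinatorics

variable {α : Type*} [LinearOrder α]

/-- The union `⋃ P` of all the blocks, that is, the set of which `P` is a set composition. -/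
def SetComp.support (P : SetComp α) : Finset α := P.blocks.toFinset.biUnion id

theorem SetComp.mem_support {P : SetComp α} {a : α} :
    a ∈ P.support ↔ ∃ B ∈ P.blocks, a ∈ B := by
  simp [SetComp.support]

/-- The operation `#`: delete the empty sets from a sequence of disjoint sets. -/
def sharp (L : List (Finset α)) (h : L.Pairwise Disjoint) : SetComp α where
  blocks := L.filter (fun B => B.Nonempty)
  nonempty := by simp
  disjoint := h.filter _

/-- The sequence `(P₁ ∩ Q₁, P₁ ∩ Q₂, …, P₁ ∩ Q_k, …, P_l ∩ Q₁, …, P_l ∩ Q_k)`. -/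
def interBlocks (L M : List (Finset α)) : List (Finset α) :=
  L.flatMap fun B => M.map fun C => B ∩ C

theorem pairwise_interBlocks {L M : List (Finset α)} (hL : L.Pairwise Disjoint)
    (hM : M.Pairwise Disjoint) : (interBlocks L M).Pairwise Disjoint := by
  unfold interBlocks
  rw [List.pairwise_flatMap]
  constructor
  · intro B _
    rw [List.pairwise_map]
    exact hM.imp fun h => h.mono Finset.inter_subset_right Finset.inter_subset_right
  · refine hL.imp fun h x hx y hy => ?_
    simp only [List.mem_map] at hx hy
    obtain ⟨_, _, rfl⟩ := hx
    obtain ⟨_, _, rfl⟩ := hy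
    exact h.mono Finset.inter_subset_left Finset.inter_subset_left

/-- The intersection of set compositions,
`(P₁ ∩ Q₁, P₁ ∩ Q₂, …, P₁ ∩ Q_k, …, P_l ∩ Q₁, …, P_l ∩ Q_k)^#`. -/
def SetComp.inter (P Q : SetComp α) : SetComp α :=
  sharp (interBlocks P.blocks Q.blocks) (pairwise_interBlocks P.disjoint Q.disjoint)

/-- The concatenation `(P₁, …, P_l, Q₁, …, Q_k)` of set compositions of disjoint sets. -/
def SetComp.concat (P Q : SetComp α) (h : Disjoint P.support Q.support) : SetComp α where
  blocks := P.blocks ++ Q.blocks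
  nonempty B hB := (List.mem_append.1 hB).elim (P.nonempty B) (Q.nonempty B)
  disjoint := List.pairwise_append.2 ⟨P.disjoint, Q.disjoint, fun _ hB _ hC =>
    h.mono (fun _ ha => SetComp.mem_support.2 ⟨_, hB, ha⟩)
      (fun _ ha => SetComp.mem_support.2 ⟨_, hC, ha⟩)⟩

/-- The set composition `({x₁}, …, {x_n})` into singletons, also written `(x₁, …, x_n)`. -/
def singletonComp {n : ℕ} (x : Fin n → α) (hx : Function.Injective x) : SetComp α where
  blocks := List.ofFn fun i => {x i}
  nonempty := by
    intro B hB
    obtain ⟨i, rfl⟩ := (List.mem_ofFn' _ _).1 hB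
    simp
  disjoint := by
    rw [List.pairwise_ofFn]
    intro i j hij
    simpa using fun h => hij.ne (hx h)

/-- `Π_A`, the set of the set compositions of the finite set `A`. -/
def SetCompOn (A : Finset α) : Type _ := {P : SetComp α // P.support = A}

theorem mem_interBlocks {L M : List (Finset α)} {a : α} :
    (∃ B ∈ interBlocks L M, a ∈ B) ↔ (∃ B ∈ L, a ∈ B) ∧ ∃ C ∈ M, a ∈ C := by
  simp only [interBlocks, List.mem_flatMap, List.mem_map]
  constructor
  · rintro ⟨_, ⟨B, hB, C, hC, rfl⟩, ha⟩
    rw [Finset.mem_inter] at ha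
    exact ⟨⟨B, hB, ha.1⟩, C, hC, ha.2⟩
  · rintro ⟨⟨B, hB, hb⟩, C, hC, hc⟩
    exact ⟨_, ⟨B, hB, C, hC, rfl⟩, Finset.mem_inter.2 ⟨hb, hc⟩⟩

theorem mem_support_sharp {L : List (Finset α)} {h : L.Pairwise Disjoint} {a : α} :
    a ∈ (sharp L h).support ↔ ∃ B ∈ L, a ∈ B := by
  rw [SetComp.mem_support]
  simp only [sharp, List.mem_filter, decide_eq_true_eq]
  exact ⟨fun ⟨B, hB, ha⟩ => ⟨B, hB.1, ha⟩, fun ⟨B, hB, ha⟩ => ⟨B, ⟨hB, a, ha⟩, ha⟩⟩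

theorem support_inter (P Q : SetComp α) : (P.inter Q).support = P.support ∩ Q.support := by
  ext a
  rw [SetComp.inter, mem_support_sharp, mem_interBlocks, Finset.mem_inter,
    SetComp.mem_support, SetComp.mem_support]

theorem filter_map_filter (L : List (Finset α)) (B : Finset α) :
    ((L.filter fun B => B.Nonempty).map fun C => B ∩ C).filter (fun B => B.Nonempty)
      = (L.map fun C => B ∩ C).filter (fun B => B.Nonempty) := by
  have h := filter_flatMap_filter L (fun C => [B ∩ C]) (by
    intro C hC D hD
    rw [Finset.not_nonempty_iff_eq_empty] at hC
    simp_all)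
  simpa only [List.flatMap_singleton', List.map_eq_flatMap] using h

theorem filter_interBlocks_left (L M : List (Finset α)) :
    (interBlocks (L.filter fun B => B.Nonempty) M).filter (fun B => B.Nonempty)
      = (interBlocks L M).filter (fun B => B.Nonempty) := by
  refine filter_flatMap_filter L _ ?_
  intro B hB C hC
  rw [Finset.not_nonempty_iff_eq_empty] at hB
  simp_all

theorem filter_interBlocks_right (L M : List (Finset α)) :
    (interBlocks L (M.filter fun B => B.Nonempty)).filter (fun B => B.Nonempty)
      = (interBlocks L M).filter (fun B => B.Nonempty) := by
  unfold interBlocks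
  rw [List.filter_flatMap, List.filter_flatMap]
  congr 1
  funext B
  exact filter_map_filter M B

theorem interBlocks_assoc (L M N : List (Finset α)) :
    interBlocks (interBlocks L M) N = interBlocks L (interBlocks M N) := by
  simp [interBlocks, List.flatMap_assoc, List.map_flatMap, List.flatMap_map, Function.comp_def,
    Finset.inter_assoc]

theorem filter_blocks (P : SetComp α) :
    P.blocks.filter (fun B => B.Nonempty) = P.blocks := by
  rw [List.filter_eq_self]
  simpa using P.nonempty

/-- The product `∧_A` on `Π_A`. -/
instance (A : Finset α) : Mul (SetCompOn A) :=
  ⟨fun P Q => ⟨P.1.inter Q.1, by rw [support_inter, P.2, Q.2, Finset.inter_self]⟩⟩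

/-- The set composition `(A)` of `A` (the empty sequence if `A = ∅`). -/
instance (A : Finset α) : One (SetCompOn A) :=
  ⟨⟨sharp [A] (List.pairwise_singleton _ _), by ext a; simp [mem_support_sharp]⟩⟩

theorem blocks_mul {A : Finset α} (P Q : SetCompOn A) : (P * Q).1.blocks =
    (interBlocks P.1.blocks Q.1.blocks).filter (fun B => B.Nonempty) := rfl

theorem blocks_one (A : Finset α) :
    (1 : SetCompOn A).1.blocks = [A].filter (fun B => B.Nonempty) := rfl

/-- `(Π_A, ∧_A)` is a monoid with identity `(A)`. -/
instance (A : Finset α) : Monoid (SetCompOn A) where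
  mul_assoc P Q R := by
    apply Subtype.ext
    apply SetComp.ext
    rw [blocks_mul, blocks_mul, blocks_mul, blocks_mul, filter_interBlocks_left,
      filter_interBlocks_right, interBlocks_assoc]
  one_mul P := by
    apply Subtype.ext
    apply SetComp.ext
    rw [blocks_mul, blocks_one, filter_interBlocks_left]
    have : interBlocks [A] P.1.blocks = P.1.blocks := by
      simp only [interBlocks, List.flatMap_cons, List.flatMap_nil, List.append_nil]
      conv_rhs => rw [← List.map_id P.1.blocks]
      refine List.map_congr_left fun B hB => ?_
      refine Finset.inter_eq_right.2 fun a ha => ?_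
      rw [← P.2]
      exact SetComp.mem_support.2 ⟨B, hB, ha⟩
    rw [this, filter_blocks]
  mul_one P := by
    apply Subtype.ext
    apply SetComp.ext
    rw [blocks_mul, blocks_one, filter_interBlocks_right]
    have : interBlocks P.1.blocks [A] = P.1.blocks := by
      simp only [interBlocks, List.map_cons, List.map_nil, ← List.map_eq_flatMap]
      conv_rhs => rw [← List.map_id P.1.blocks]
      refine List.map_congr_left fun B hB => ?_
      refine Finset.inter_eq_left.2 fun a ha => ?_
      rw [← P.2]
      exact SetComp.mem_support.2 ⟨B, hB, ha⟩
    rw [this, filter_blocks]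

theorem nodup_blocks (P : SetComp α) : P.blocks.Nodup := by
  refine (List.Pairwise.and_mem.1 P.disjoint).imp fun {B C} h e => ?_
  subst e
  exact (P.nonempty B h.1).ne_empty (disjoint_self.1 h.2.2)

instance (A : Finset α) : Finite (SetCompOn A) := by
  let f : SetCompOn A → {l : List A.powerset // l.length ≤ Fintype.card A.powerset} := fun P =>
    ⟨P.1.blocks.attach.map fun B => ⟨B.1, Finset.mem_powerset.2 fun a ha => by
        rw [← P.2]
        exact SetComp.mem_support.2 ⟨B.1, B.2, ha⟩⟩, by
      apply List.Nodup.length_le_card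
      refine List.Nodup.map (fun B C h => ?_) (List.nodup_attach.2 (nodup_blocks P.1))
      exact Subtype.ext (congrArg (fun C : A.powerset => C.1) h)⟩
  have : Finite {l : List A.powerset // l.length ≤ Fintype.card A.powerset} :=
    (List.finite_length_le _ _).to_subtype
  refine Finite.of_injective f fun P Q h => ?_
  apply Subtype.ext
  apply SetComp.ext
  have h' := congrArg (fun l => l.1.map Subtype.val) h
  simpa [f, List.map_map, Function.comp_def] using h'

instance (A : Finset α) : Fintype (SetCompOn A) := Fintype.ofFinite _

/-- `P = (P₁, …, P_l) ∈ Π_A` lies in `Π_A^*`, that is, `min A ∈ P₁`. -/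
def SetCompOn.MinInHead {A : Finset α} (P : SetCompOn A) : Prop :=
  ∃ B ∈ P.1.blocks.head?, ∃ a ∈ B, IsLeast (A : Set α) a

end Combinatorics

section Algebra

variable (F : Type*) [Field F] {α : Type*} [LinearOrder α]

/-- The space `FΠ = ⨁_A FΠ_A` with basis `Π`. -/
abbrev FreeTwisted (α : Type*) [LinearOrder α] : Type _ := SetComp α →₀ F

/-- The algebra `(FΠ_A, ∧_A)`, the monoid algebra of `(Π_A, ∧_A)` over `F`. -/
abbrev Alg (A : Finset α) : Type _ := MonoidAlgebra F (SetCompOn A)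

/-- The inclusion of `FΠ_A` in `FΠ`. -/
def incl (A : Finset α) : Alg F A →ₗ[F] FreeTwisted F α :=
  Finsupp.lmapDomain F F (fun P : SetCompOn A => P.1) ∘ₗ
    (MonoidAlgebra.coeffLinearEquiv F).toLinearMap

/-- The intersection product `∧` on `FΠ`: the bilinear extension of `P ∧ Q = P ∧_A Q` if
`⋃ P = A = ⋃ Q`, and `P ∧ Q = 0` if `⋃ P ≠ ⋃ Q`. -/
def wedge : FreeTwisted F α →ₗ[F] FreeTwisted F α →ₗ[F] FreeTwisted F α :=
  Finsupp.linearCombination F fun P => Finsupp.linearCombination F fun Q =>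
    if P.support = Q.support then Finsupp.single (P.inter Q) 1 else 0

/-- The concatenation product `∨` on `FΠ`: the bilinear extension of
`P ∨ Q = (P₁, …, P_l, Q₁, …, Q_k)` if `⋃ P ∩ ⋃ Q = ∅`, and `P ∨ Q = 0` otherwise. -/
def vee : FreeTwisted F α →ₗ[F] FreeTwisted F α →ₗ[F] FreeTwisted F α :=
  Finsupp.linearCombination F fun P => Finsupp.linearCombination F fun Q =>
    if h : Disjoint P.support Q.support then Finsupp.single (P.concat Q h) 1 else 0

/-- The empty set composition, the identity of `(FΠ, ∨)`. -/
def emptyComp : SetComp α := ⟨[], by simp, List.Pairwise.nil⟩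

open Classical in
/-- `e_A = ∑_{P ∈ Π_A^*} (-1)^(ℓ(P) - 1) P`, for a non-empty finite set `A`. -/
def eSet (A : Finset α) : FreeTwisted F α :=
  ∑ P : SetCompOn A with P.MinInHead,
    (-1 : F) ^ (P.1.blocks.length - 1) • Finsupp.single P.1 1

/-- `e_Q = e_{Q₁} ∨ ⋯ ∨ e_{Q_k}` for a set composition `Q = (Q₁, …, Q_k)`. -/
def eComp (Q : SetComp α) : FreeTwisted F α :=
  (Q.blocks.map (eSet F)).foldr (fun f g => vee F f g) (Finsupp.single emptyComp 1)

/-- The linear extension `FΠ → FΠ`, `∑ f_R R ↦ ∑ f_R e_R`, of `Q ↦ e_Q`. -/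
def eLin : FreeTwisted F α →ₗ[F] FreeTwisted F α :=
  Finsupp.linearCombination F (eComp F)

/-- The Lie product `f ∘ g = f ∨ g - g ∨ f`. -/
def lie (f g : FreeTwisted F α) : FreeTwisted F α := vee F f g - vee F g f

/-- The recursion for `Q ↦ Q°` on the list of blocks of `Q`. -/
def dynkinAux : (L : List (Finset α)) → (∀ B ∈ L, B.Nonempty) → L.Pairwise Disjoint →
    FreeTwisted F α
  | [], _, _ => Finsupp.single emptyComp 1
  | [B], hn, hd => Finsupp.single ⟨[B], hn, hd⟩ 1
  | B :: C :: L, hn, hd =>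
      lie F
        (Finsupp.single ⟨[B], fun _ h => hn _ (by simp_all), List.pairwise_singleton _ _⟩ 1)
        (dynkinAux (C :: L) (fun D h => hn D (List.mem_cons_of_mem _ h)) hd.of_cons)

/-- The right-normed Dynkin mapping on set compositions: `(A)° = (A)` and
`(Q₁, …, Q_k)° = Q₁ ∘ (Q₂, …, Q_k)°` for `k > 1`. -/
def dynkin (Q : SetComp α) : FreeTwisted F α := dynkinAux F Q.blocks Q.nonempty Q.disjoint

end Algebra

/-- The descending Loewy series of an `R`-module `M`: `rad^(0) M = M` and
`rad^(k+1) M = rad (rad^(k) M)`, where the radical of a module is the intersection of all its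
maximal submodules. -/
def radSeries (R M : Type*) [Ring R] [AddCommGroup M] [Module R M] : ℕ → Submodule R M
  | 0 => ⊤
  | k + 1 => (Module.jacobson R (radSeries R M k)).map (radSeries R M k).subtype

/-- `rad^(k) FΠ_A`, the `k`-th term of the descending Loewy series of the regular module of `FΠ_A`,
as a linear subspace of `FΠ_A`. -/
def radAlg (F : Type*) [Field F] {α : Type*} [LinearOrder α] (A : Finset α) (k : ℕ) :
    Submodule F (Alg F A) :=
  (radSeries (Alg F A) (Alg F A) k).restrictScalars F

end SolomonTits

end

open SolomonTits

namespace SolomonTits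

/-! ### The radical series of an Artinian ring -/

section Radical

/-! Multiplying on the right never decreases the number of blocks, and `R * P = R` exactly when `R`
refines `P`. Hence right multiplication acts by scalars, the characters `refineChar`, on the layers
of the filtration `longSpan` by number of blocks. The joint kernel of these characters is nilpotent
and is the Jacobson radical (`jacobson_eq_charKernel`). Each radical factor climbs one layer, so
rad^(k) lies in the span of compositions with at least `k + 1` blocks (`radSeries_mem_longSpan`).
Therefore rad^(n) = 0, rad^(n-1) is spanned by linear combinations of words (compositions into
singletons), and any composition with at least two blocks annihilates rad^(n-1) from the left.

Conversely, a Dynkin element of a composition with `k` blocks lies in rad^(k-1)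
(`exists_radSeries_adList`): it is built from `(A)` by right factors `(A \ B, B) - (B, A \ B)`.
These lie in the radical because both terms have the same underlying partition, and each replaces a
merged block inside a nested bracket by a commutator.

To pin down rad^(n-1), fix `a ∈ A`. A combination of words killed on the left by all `(A \ T, T)`
with `a ∉ T` satisfies shuffle relations, and these determine it from its coefficients at words
ending in `a` (`eq_zero_of_shuffle`). On those words the Dynkin elements are a dual basis
(`coeff_adList`), so such combinations are exactly the span of the `(n-1)!` Dynkin elements with
last letter `a`. For `a = min A`, a sign-reversing involution shows that `(A \ T, T)` kills `e_A`
(`of_mul_eAlg`), so `e_A ∧ f ∧ w` lies in this span for every word `w`. In the other direction `e_A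
- 1` has only terms with at least two blocks, so `e_A` fixes rad^(n-1) from the left, while words
absorb right factors. -/

/-- `M / JM` is a module over the semisimple ring `R / J`, hence semisimple with zero radical. No
finiteness of `M` is needed. -/
theorem jacobson_eq_smul_top (R M : Type*) [Ring R] [IsArtinianRing R] [AddCommGroup M]
    [Module R M] : Module.jacobson R M = Ring.jacobson R • (⊤ : Submodule R M) := by
  refine le_antisymm (Module.jacobson_le_of_eq_bot ?_) (Ring.jacobson_smul_top_le R M)
  have h : Module.IsTorsionBySet R (M ⧸ Ring.jacobson R • (⊤ : Submodule R M))
      (Ring.jacobson R : Set R) := by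
    rintro x ⟨r, hr⟩
    induction x using Submodule.Quotient.induction_on with
    | H x =>
      exact (Submodule.Quotient.mk_eq_zero _).2 (Submodule.smul_mem_smul hr trivial)
  let _ := h.module
  have := (h.semilinearMap.isSemisimpleModule_iff_of_bijective Function.bijective_id).2
    (inferInstanceAs (IsSemisimpleModule (R ⧸ Ring.jacobson R) _))
  exact IsSemisimpleModule.jacobson_eq_bot R _

variable (R : Type*) [Ring R] [IsArtinianRing R]

theorem radSeries_succ (k : ℕ) :
    radSeries R R (k + 1) = Ring.jacobson R • radSeries R R k := by
  rw [radSeries, jacobson_eq_smul_top, Submodule.map_smul'', Submodule.map_top,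
    Submodule.range_subtype]

/-- The recursion adds radical factors on the left, but the Dynkin elements are built by right
factors. Associativity and the fact that `J` is a left ideal bridge the two. -/
theorem mul_mem_radSeries_succ {k : ℕ} {x y : R} (hx : x ∈ radSeries R R k)
    (hy : y ∈ Ring.jacobson R) : x * y ∈ radSeries R R (k + 1) := by
  induction k generalizing x with
  | zero =>
    rw [radSeries_succ]
    have : x * y ∈ Ring.jacobson R := (Ring.jacobson R).mul_mem_left x hy
    simpa using Submodule.smul_mem_smul this (show (1 : R) ∈ radSeries R R 0 from trivial)
  | succ k ih =>
    rw [radSeries_succ] at hx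
    induction hx using Submodule.smul_induction_on' with
    | smul r hr z hz =>
      rw [radSeries_succ, show r • z * y = r * (z * y) from mul_assoc r z y]
      exact Submodule.smul_mem_smul hr (ih hz)
    | add a _ b _ h1 h2 => rw [add_mul]; exact add_mem h1 h2

end Radical

/-! ### Refinement and the number of blocks -/

section Refinement

theorem flatMap_length_facts {β : Type*} (L : List β) (f : β → List β)
    (h0 : ∀ B ∈ L, f B ≠ []) (h1 : ∀ B ∈ L, (f B).length = 1 → f B = [B]) :
    L.length ≤ (L.flatMap f).length ∧ ((L.flatMap f).length = L.length → L.flatMap f = L) := by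
  induction L with
  | nil => simp
  | cons B L ih =>
    obtain ⟨ih1, ih2⟩ := ih (fun C hC => h0 C (by simp [hC])) (fun C hC => h1 C (by simp [hC]))
    have hB : 1 ≤ (f B).length := List.length_pos_iff.2 (h0 B (by simp))
    simp only [List.flatMap_cons, List.length_append, List.length_cons]
    refine ⟨by omega, fun h => ?_⟩
    rw [h1 B (by simp) (by omega), ih2 (by omega)]
    rfl

variable {α : Type*} [LinearOrder α] {A : Finset α}

theorem SetCompOn.exists_mem_block (P : SetCompOn A) {a : α} (ha : a ∈ A) :
    ∃ B ∈ P.1.blocks, a ∈ B := by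
  rw [← P.2] at ha
  exact SetComp.mem_support.1 ha

theorem SetCompOn.block_subset (P : SetCompOn A) {B : Finset α} (hB : B ∈ P.1.blocks) :
    B ⊆ A := by
  intro a ha
  rw [← P.2]
  exact SetComp.mem_support.2 ⟨B, hB, ha⟩

theorem SetCompOn.ext_blocks {P Q : SetCompOn A} (h : P.1.blocks = Q.1.blocks) : P = Q :=
  Subtype.ext (SetComp.ext h)

/-- The number of blocks of a set composition. -/
def SetCompOn.len (P : SetCompOn A) : ℕ := P.1.blocks.length

/-- `R` refines `P` as a set partition. -/
def SetCompOn.Refines (R P : SetCompOn A) : Prop :=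
  ∀ B ∈ R.1.blocks, ∃ C ∈ P.1.blocks, B ⊆ C

theorem blocks_mul_eq_flatMap (P Q : SetCompOn A) : (P * Q).1.blocks =
    P.1.blocks.flatMap fun B => (Q.1.blocks.map fun C => B ∩ C).filter fun B => B.Nonempty := by
  rw [blocks_mul, interBlocks, List.filter_flatMap]

theorem mem_blocks_mul {P Q : SetCompOn A} {X : Finset α} : X ∈ (P * Q).1.blocks ↔
    X.Nonempty ∧ ∃ B ∈ P.1.blocks, ∃ C ∈ Q.1.blocks, B ∩ C = X := by
  rw [blocks_mul, List.mem_filter]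
  simp only [interBlocks, List.mem_flatMap, List.mem_map, decide_eq_true_eq]
  exact and_comm

/-- Each block of `P` is replaced by its nonempty traces on `Q`. There is at least one, and if there
is only one it is the whole block. -/
theorem len_mul_facts (P Q : SetCompOn A) :
    P.len ≤ (P * Q).len ∧ ((P * Q).len = P.len → P * Q = P) := by
  have h := flatMap_length_facts P.1.blocks
    (fun B => (Q.1.blocks.map fun C => B ∩ C).filter fun B => B.Nonempty) (by
      intro B hB
      obtain ⟨a, ha⟩ := P.1.nonempty B hB
      obtain ⟨C, hC, haC⟩ := Q.exists_mem_block (P.block_subset hB ha)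
      apply List.ne_nil_of_mem (a := B ∩ C)
      simp only [List.mem_filter, List.mem_map, decide_eq_true_eq]
      exact ⟨⟨C, hC, rfl⟩, a, Finset.mem_inter.2 ⟨ha, haC⟩⟩) (by
      intro B hB h1
      obtain ⟨X, hX⟩ := List.length_eq_one_iff.1 h1
      have hmem : ∀ C ∈ Q.1.blocks, (B ∩ C).Nonempty → B ∩ C = X := by
        intro C hC hne
        have : B ∩ C ∈ (Q.1.blocks.map fun C => B ∩ C).filter fun B => B.Nonempty := by
          simp only [List.mem_filter, List.mem_map, decide_eq_true_eq]
          exact ⟨⟨C, hC, rfl⟩, hne⟩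
        rw [hX] at this
        simpa using this
      have hXm : X ∈ (Q.1.blocks.map fun C => B ∩ C).filter fun B => B.Nonempty := by
        rw [hX]; simp
      simp only [List.mem_filter, List.mem_map] at hXm
      obtain ⟨⟨C, hC, hCX⟩, -⟩ := hXm
      rw [hX]
      congr 1
      refine subset_antisymm (hCX ▸ Finset.inter_subset_left) fun a ha => ?_
      obtain ⟨D, hD, haD⟩ := Q.exists_mem_block (P.block_subset hB ha)
      have haBD := Finset.mem_inter.2 ⟨ha, haD⟩
      rwa [hmem D hD ⟨a, haBD⟩] at haBD)
  rw [← blocks_mul_eq_flatMap] at h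
  exact ⟨h.1, fun h' => SetCompOn.ext_blocks (h.2 h')⟩

/-- A block of `R` meets only the block of `P` that contains it, so every other intersection is
deleted. -/
theorem SetCompOn.Refines.mul_eq {R P : SetCompOn A} (h : R.Refines P) : R * P = R := by
  apply SetCompOn.ext_blocks
  rw [blocks_mul_eq_flatMap]
  conv_rhs => rw [← List.flatMap_singleton' R.1.blocks]
  refine List.flatMap_congr fun B hB => ?_
  obtain ⟨C, hC, hBC⟩ := h B hB
  obtain ⟨s, t, hst⟩ := List.append_of_mem hC
  have hdis := P.1.disjoint
  rw [hst, List.pairwise_append, List.pairwise_cons] at hdis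
  have hs : ∀ D ∈ s, ¬ (B ∩ D).Nonempty := fun D hD => by
    rw [← Finset.not_disjoint_iff_nonempty_inter, not_not]
    exact ((hdis.2.2 D hD C (by simp)).mono_right hBC).symm
  have ht : ∀ D ∈ t, ¬ (B ∩ D).Nonempty := fun D hD => by
    rw [← Finset.not_disjoint_iff_nonempty_inter, not_not]
    exact (hdis.2.1.1 D hD).mono_left hBC
  rw [hst, List.map_append, List.map_cons, List.filter_append, List.filter_cons,
    List.filter_eq_nil_iff.2 (by simpa using hs), List.filter_eq_nil_iff.2 (by simpa using ht),
    Finset.inter_eq_left.2 hBC]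
  simp [R.1.nonempty B hB]

theorem SetCompOn.refines_of_mul_eq {R P : SetCompOn A} (h : R * P = R) : R.Refines P := by
  intro B hB
  rw [← h, mem_blocks_mul] at hB
  obtain ⟨-, D, -, C, hC, rfl⟩ := hB
  exact ⟨C, hC, Finset.inter_subset_right⟩

theorem SetCompOn.refines_mul_iff {R P Q : SetCompOn A} :
    R.Refines (P * Q) ↔ R.Refines P ∧ R.Refines Q := by
  constructor
  · intro h
    constructor <;> intro B hB <;> obtain ⟨X, hX, hBX⟩ := h B hB <;> rw [mem_blocks_mul] at hX <;>
      obtain ⟨-, C, hC, D, hD, rfl⟩ := hX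
    · exact ⟨C, hC, hBX.trans Finset.inter_subset_left⟩
    · exact ⟨D, hD, hBX.trans Finset.inter_subset_right⟩
  · rintro ⟨h1, h2⟩ B hB
    obtain ⟨C, hC, hBC⟩ := h1 B hB
    obtain ⟨D, hD, hBD⟩ := h2 B hB
    have hsub := Finset.subset_inter hBC hBD
    exact ⟨C ∩ D, mem_blocks_mul.2 ⟨(R.1.nonempty B hB).mono hsub, C, hC, D, hD, rfl⟩, hsub⟩

theorem SetCompOn.refines_one (R : SetCompOn A) : R.Refines 1 := fun B hB =>
  ⟨A, by
    rw [blocks_one]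
    simpa using (R.1.nonempty B hB).mono (R.block_subset hB), R.block_subset hB⟩

theorem SetCompOn.card_eq_sum (P : SetCompOn A) :
    (P.1.blocks.map Finset.card).sum = A.card := by
  have key : ∀ L : List (Finset α), L.Pairwise Disjoint →
      (L.toFinset.biUnion id).card = (L.map Finset.card).sum := by
    intro L
    induction L with
    | nil => simp
    | cons B L ih =>
      intro h
      rw [List.pairwise_cons] at h
      rw [List.toFinset_cons, Finset.biUnion_insert, Finset.card_union_of_disjoint, ih h.2]
      · simp
      · rw [Finset.disjoint_biUnion_right]
        intro C hC
        exact h.1 C (List.mem_toFinset.1 hC)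
  rw [← key _ P.1.disjoint]
  exact congrArg _ P.2

theorem SetCompOn.len_le_card (P : SetCompOn A) : P.len ≤ A.card := by
  rw [← P.card_eq_sum, SetCompOn.len, ← List.length_map (f := Finset.card)]
  apply List.length_le_sum_of_one_le
  intro i hi
  obtain ⟨B, hB, rfl⟩ := List.mem_map.1 hi
  exact (P.1.nonempty B hB).card_pos

theorem SetCompOn.len_pos (hA : A.Nonempty) (P : SetCompOn A) : 1 ≤ P.len := by
  obtain ⟨a, ha⟩ := hA
  obtain ⟨B, hB, -⟩ := P.exists_mem_block ha
  exact List.length_pos_of_mem hB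

theorem SetCompOn.eq_one_of_len (P : SetCompOn A) (h : P.len ≤ 1) : P = 1 := by
  by_cases h0 : P.1.blocks = []
  · have hA : A = ∅ := by rw [← P.2, SetComp.support, h0]; rfl
    apply SetCompOn.ext_blocks
    rw [blocks_one, h0, hA]
    rfl
  · have h1 : P.1.blocks.length = 1 := le_antisymm h (List.length_pos_iff.2 h0)
    obtain ⟨B, hB⟩ := List.length_eq_one_iff.1 h1
    have hA : A = B := by rw [← P.2, SetComp.support, hB]; simp
    apply SetCompOn.ext_blocks
    have := P.1.nonempty B (by simp [hB])
    rw [blocks_one, hB, hA]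
    simp [this]

theorem SetCompOn.exists_singletons (P : SetCompOn A) (h : A.card ≤ P.len) :
    ∃ l : List α, P.1.blocks = l.map fun a => {a} := by
  have key : ∀ L : List (Finset α), (∀ B ∈ L, B.Nonempty) → L.length ≤ (L.map Finset.card).sum ∧
      ((L.map Finset.card).sum ≤ L.length → ∃ l : List α, L = l.map fun a => {a}) := by
    intro L
    induction L with
    | nil => exact fun _ => ⟨by simp, fun _ => ⟨[], rfl⟩⟩
    | cons B L ih =>
      intro hL
      obtain ⟨ih1, ih2⟩ := ih fun C hC => hL C (by simp [hC])
      have hB := (hL B (by simp)).card_pos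
      simp only [List.length_cons, List.map_cons, List.sum_cons]
      refine ⟨by omega, fun h => ?_⟩
      obtain ⟨l, rfl⟩ := ih2 (by omega)
      obtain ⟨a, rfl⟩ := Finset.card_eq_one.1 (show B.card = 1 by omega)
      exact ⟨a :: l, rfl⟩
  exact (key P.1.blocks P.1.nonempty).2 (by rw [P.card_eq_sum]; exact h)

end Refinement

/-! ### Block filtration, characters and the Jacobson radical -/

section Filtration

variable (F : Type*) [Field F] {α : Type*} [LinearOrder α] (A : Finset α)

/-- The span of the set compositions with at least `k` blocks. -/
noncomputable def longSpan (k : ℕ) : Submodule F (Alg F A) :=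
  Submodule.span F (MonoidAlgebra.of F (SetCompOn A) '' {P | k ≤ P.len})

variable {F A}

theorem of_mem_longSpan {k : ℕ} {P : SetCompOn A} (h : k ≤ P.len) :
    MonoidAlgebra.of F _ P ∈ longSpan F A k :=
  Submodule.subset_span ⟨P, h, rfl⟩

theorem longSpan_le {k : ℕ} {V : Submodule F (Alg F A)}
    (h : ∀ P : SetCompOn A, k ≤ P.len → MonoidAlgebra.of F _ P ∈ V) : longSpan F A k ≤ V := by
  rw [longSpan, Submodule.span_le]
  rintro _ ⟨P, hP, rfl⟩
  exact h P hP

theorem longSpan_mono {j k : ℕ} (h : j ≤ k) : longSpan F A k ≤ longSpan F A j :=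
  longSpan_le fun _ hP => of_mem_longSpan (h.trans hP)

theorem coeff_eq_zero_of_mem_longSpan {k : ℕ} {x : Alg F A} (hx : x ∈ longSpan F A k)
    {P : SetCompOn A} (hP : P.len < k) : x.coeff P = 0 := by
  have : longSpan F A k ≤ LinearMap.ker
      (Finsupp.lapply P ∘ₗ (MonoidAlgebra.coeffLinearEquiv F).toLinearMap) := by
    refine longSpan_le fun Q hQ => ?_
    have hne : Q ≠ P := by rintro rfl; omega
    simp [hne]
  exact this hx

theorem longSpan_card_succ : longSpan F A (A.card + 1) = ⊥ :=
  eq_bot_iff.2 <| longSpan_le fun P hP => absurd P.len_le_card (by omega)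

theorem span_of_eq_top : Submodule.span F (Set.range (MonoidAlgebra.of F (SetCompOn A))) = ⊤ := by
  refine eq_top_iff.2 fun x _ => ?_
  induction x using MonoidAlgebra.induction_on with
  | of P => exact Submodule.subset_span ⟨P, rfl⟩
  | add x y hx hy => exact add_mem (hx trivial) (hy trivial)
  | smul r x hx => exact Submodule.smul_mem _ _ (hx trivial)

theorem longSpan_one (hA : A.Nonempty) : longSpan F A 1 = ⊤ := by
  refine eq_top_iff.2 ?_
  rw [← span_of_eq_top, Submodule.span_le]
  rintro _ ⟨P, rfl⟩
  exact of_mem_longSpan (P.len_pos hA)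

open Classical in
variable (F) in
/-- The character of `FΠ_A` that sends `P` to `1` if `R` refines `P`, and to `0` otherwise. -/
noncomputable def refineChar (R : SetCompOn A) : Alg F A →ₐ[F] F :=
  MonoidAlgebra.lift F F (SetCompOn A)
    { toFun := fun P => if R.Refines P then 1 else 0
      map_one' := by simp [R.refines_one]
      map_mul' := fun P Q => by
        simp only [SetCompOn.refines_mul_iff]
        split_ifs <;> simp_all }

open Classical in
theorem refineChar_of (R P : SetCompOn A) :
    refineChar F R (MonoidAlgebra.of F _ P) = if R.Refines P then 1 else 0 := by
  rw [refineChar, MonoidAlgebra.lift_of]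
  rfl

/-- The triangularity behind all upper bounds: if `R` does not refine `P`, then `R * P ≠ R` must
have strictly more blocks. -/
theorem of_mul_sub_mem_longSpan (R : SetCompOn A) (x : Alg F A) :
    MonoidAlgebra.of F _ R * x - refineChar F R x • MonoidAlgebra.of F _ R
      ∈ longSpan F A (R.len + 1) := by
  induction x using MonoidAlgebra.induction_on with
  | of P =>
    rw [refineChar_of, ← map_mul]
    split_ifs with h
    · simp [h.mul_eq]
    · rw [zero_smul, sub_zero]
      refine of_mem_longSpan ?_
      have := len_mul_facts R P
      refine lt_of_le_of_ne this.1 fun h' => h (SetCompOn.refines_of_mul_eq (this.2 h'.symm))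
  | add x y hx hy =>
    convert! add_mem hx hy using 1
    rw [map_add, mul_add, add_smul]
    abel
  | smul r x hx =>
    convert! Submodule.smul_mem _ r hx using 1
    rw [map_smul, mul_smul_comm, smul_sub, smul_assoc]

/-- The joint kernel of the characters of `FΠ_A`. -/
noncomputable def charKernel (F : Type*) [Field F] (A : Finset α) : Ideal (Alg F A) :=
  ⨅ R : SetCompOn A, RingHom.ker (refineChar F R)

theorem mem_charKernel {x : Alg F A} :
    x ∈ charKernel F A ↔ ∀ R : SetCompOn A, refineChar F R x = 0 := by
  simp [charKernel, Submodule.mem_iInf, RingHom.mem_ker]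

theorem mul_mem_longSpan_succ {k : ℕ} {z x : Alg F A} (hz : z ∈ longSpan F A k)
    (hx : x ∈ charKernel F A) : z * x ∈ longSpan F A (k + 1) := by
  have : longSpan F A k ≤ (longSpan F A (k + 1)).comap (LinearMap.mulRight F x) := by
    refine longSpan_le fun R hR => ?_
    have h := of_mul_sub_mem_longSpan R x
    rw [mem_charKernel.1 hx, zero_smul, sub_zero] at h
    exact longSpan_mono (Nat.succ_le_succ hR) h
  exact this hz

theorem pow_mem_longSpan (hA : A.Nonempty) {x : Alg F A} (hx : x ∈ charKernel F A) (k : ℕ) :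
    x ^ k ∈ longSpan F A (k + 1) := by
  induction k with
  | zero => rw [longSpan_one hA]; trivial
  | succ k ih => rw [pow_succ]; exact mul_mem_longSpan_succ ih hx

/-- A character onto a field has a maximal kernel, which gives one inclusion. For the other, each
left multiple of an element of the joint kernel is nilpotent, as its powers climb past `A.card`
blocks. -/
theorem jacobson_eq_charKernel (hA : A.Nonempty) :
    Ring.jacobson (Alg F A) = charKernel F A := by
  apply le_antisymm
  · refine le_iInf fun R => ?_
    have : (RingHom.ker (refineChar F R)).IsMaximal :=
      RingHom.ker_isMaximal_of_surjective _ fun r =>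
        ⟨algebraMap F _ r, (refineChar F R).commutes r⟩
    exact Ring.jacobson_le_of_isMaximal _
  · intro x hx
    rw [← Ideal.jacobson_bot (R := Alg F A), Ideal.mem_jacobson_iff]
    intro y
    have hy : y * x ∈ charKernel F A := Ideal.mul_mem_left _ _ hx
    have hn : IsNilpotent (y * x) := ⟨A.card, by
      have := pow_mem_longSpan hA hy A.card
      rwa [longSpan_card_succ, Submodule.mem_bot] at this⟩
    obtain ⟨u, hu⟩ := hn.isUnit_one_add
    refine ⟨(u⁻¹ : (Alg F A)ˣ), ?_⟩
    have : (u⁻¹ : (Alg F A)ˣ) * (1 + y * x) = 1 := by rw [← hu]; simp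
    rw [Submodule.mem_bot, ← this]
    noncomm_ring

instance : IsArtinianRing (Alg F A) := IsArtinianRing.of_finite F _

/-- Reassociating `z * (r * y) = (z * r) * y` moves a radical factor onto `z`, which climbs one
layer. The induction therefore has to let `z` and `j` vary. -/
theorem mul_radSeries_mem_longSpan (hA : A.Nonempty) {j k : ℕ} {z x : Alg F A}
    (hz : z ∈ longSpan F A j) (hx : x ∈ radSeries (Alg F A) (Alg F A) k) :
    z * x ∈ longSpan F A (j + k) := by
  induction k generalizing j z x with
  | zero =>
    have : longSpan F A j ≤ (longSpan F A j).comap (LinearMap.mulRight F x) := by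
      refine longSpan_le fun R hR => ?_
      have h := of_mul_sub_mem_longSpan R x
      have h' := Submodule.smul_mem _ (refineChar F R x) (of_mem_longSpan (F := F) hR)
      have h'' := add_mem (longSpan_mono (hR.trans (Nat.le_succ _)) h) h'
      rwa [sub_add_cancel] at h''
    exact this hz
  | succ k ih =>
    rw [radSeries_succ, jacobson_eq_charKernel hA] at hx
    induction hx using Submodule.smul_induction_on' with
    | smul r hr y hy =>
      rw [show z * r • y = z * r * y from (mul_assoc z r y).symm,
        show j + (k + 1) = j + 1 + k by ring]
      exact ih (mul_mem_longSpan_succ hz hr) hy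
    | add a _ b _ h1 h2 => rw [mul_add]; exact add_mem h1 h2

theorem radSeries_mem_longSpan (hA : A.Nonempty) {k : ℕ} {x : Alg F A}
    (hx : x ∈ radSeries (Alg F A) (Alg F A) k) : x ∈ longSpan F A (1 + k) := by
  have := mul_radSeries_mem_longSpan hA (show (1 : Alg F A) ∈ longSpan F A 1 by
    rw [longSpan_one hA]; trivial) hx
  rwa [one_mul] at this

end Filtration

/-! ### Dynkin brackets in the free algebra and the radical series -/

section FreeAlgebra

variable (F : Type*) [Field F] {α : Type*} [LinearOrder α]

/-- The free associative algebra on the finite subsets of `α`. -/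
abbrev WordAlg (α : Type*) : Type _ := MonoidAlgebra F (FreeMonoid (Finset α))

/-- The generator of the free algebra that belongs to a block. -/
noncomputable def letter (B : Finset α) : WordAlg F α := MonoidAlgebra.of F _ (FreeMonoid.of B)

/-- The embedding of `FΠ` in the free algebra on blocks. -/
noncomputable def toWord : FreeTwisted F α →ₗ[F] WordAlg F α :=
  (MonoidAlgebra.coeffLinearEquiv F).symm.toLinearMap ∘ₗ
    Finsupp.lmapDomain F F (fun P : SetComp α => FreeMonoid.ofList P.blocks)

theorem toWord_single (P : SetComp α) (r : F) :
    toWord F (Finsupp.single P r) = MonoidAlgebra.single (FreeMonoid.ofList P.blocks) r := by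
  simp [toWord]

theorem toWord_injective : Function.Injective (toWord F (α := α)) := by
  intro x y h
  refine Finsupp.mapDomain_injective (f := fun P : SetComp α => FreeMonoid.ofList P.blocks) ?_
    ((MonoidAlgebra.coeffLinearEquiv F).symm.injective h)
  exact fun P Q h => SetComp.ext (FreeMonoid.ofList.injective h)

theorem incl_of {A : Finset α} (P : SetCompOn A) :
    incl F A (MonoidAlgebra.of F _ P) = Finsupp.single P.1 1 := by
  simp [incl]

theorem wedge_incl {A : Finset α} (x y : Alg F A) :
    wedge F (incl F A x) (incl F A y) = incl F A (x * y) := by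
  induction x using MonoidAlgebra.induction_on with
  | of P =>
    induction y using MonoidAlgebra.induction_on with
    | of Q =>
      rw [← map_mul, incl_of, incl_of, incl_of]
      simp only [wedge, Finsupp.linearCombination_single, one_smul, P.2, Q.2, if_true]
      rfl
    | add x y hx hy => rw [map_add, map_add, mul_add, map_add, hx, hy]
    | smul r x hx => rw [map_smul, map_smul, mul_smul_comm, map_smul, hx]
  | add x y hx hy => rw [map_add, map_add, add_mul, map_add, LinearMap.add_apply, hx, hy]
  | smul r x hx => rw [map_smul, map_smul, smul_mul_assoc, map_smul, LinearMap.smul_apply, hx]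

/-- The endomorphism of the free algebra that replaces a letter `B` by the word
`(B ∩ M₁, …, B ∩ M_k)^#`. -/
noncomputable def refineHom (M : List (Finset α)) : WordAlg F α →ₐ[F] WordAlg F α :=
  MonoidAlgebra.lift F _ _ ((MonoidAlgebra.of F _).comp (FreeMonoid.lift fun B =>
    FreeMonoid.ofList ((M.map fun C => B ∩ C).filter fun B => B.Nonempty)))

theorem refineHom_letter (M : List (Finset α)) (B : Finset α) : refineHom F M (letter F B) =
    MonoidAlgebra.of F _
      (FreeMonoid.ofList ((M.map fun C => B ∩ C).filter fun B => B.Nonempty)) := by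
  rw [letter, refineHom, MonoidAlgebra.lift_of]
  simp

theorem ofList_flatMap {β γ : Type*} (L : List β) (f : β → List γ) :
    FreeMonoid.ofList (L.flatMap f) =
      FreeMonoid.lift (fun B => FreeMonoid.ofList (f B)) (FreeMonoid.ofList L) := by
  induction L with
  | nil => rfl
  | cons B L ih => rw [List.flatMap_cons, FreeMonoid.ofList_append, ih, FreeMonoid.ofList_cons,
      map_mul, FreeMonoid.lift_eval_of]

/-- Right multiplication refines each block independently, so it becomes a substitution of letters.
As an algebra endomorphism, this commutes with forming commutators. -/
theorem toWord_incl_mul {A : Finset α} (f : Alg F A) (M : SetCompOn A) :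
    toWord F (incl F A (f * MonoidAlgebra.of F _ M)) =
      refineHom F M.1.blocks (toWord F (incl F A f)) := by
  induction f using MonoidAlgebra.induction_on with
  | of P =>
    rw [← map_mul, incl_of, incl_of, toWord_single, toWord_single, ← MonoidAlgebra.of_apply,
      ← MonoidAlgebra.of_apply, blocks_mul_eq_flatMap, ofList_flatMap, refineHom,
      MonoidAlgebra.lift_of]
    rfl
  | add x y hx hy => rw [add_mul, map_add, map_add, hx, hy, map_add, map_add, map_add]
  | smul r x hx =>
    rw [smul_mul_assoc, map_smul, map_smul, hx, map_smul, map_smul, map_smul]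

/-- The iterated commutator `[B₁, [B₂, … [B_k, t]]]`. -/
noncomputable def adList (L : List (Finset α)) (t : WordAlg F α) : WordAlg F α :=
  L.foldr (fun B s => letter F B * s - s * letter F B) t

variable {F}

omit [LinearOrder α] in
theorem adList_sub (L : List (Finset α)) (s t : WordAlg F α) :
    adList F L (s - t) = adList F L s - adList F L t := by
  induction L with
  | nil => rfl
  | cons B L ih =>
    simp only [adList, List.foldr_cons] at ih ⊢
    rw [ih]
    noncomm_ring

omit [LinearOrder α] in
theorem map_adList (φ : WordAlg F α →ₐ[F] WordAlg F α) (L : List (Finset α)) (t : WordAlg F α)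
    (h : ∀ B ∈ L, φ (letter F B) = letter F B) : φ (adList F L t) = adList F L (φ t) := by
  induction L with
  | nil => rfl
  | cons B L ih =>
    have ih := ih fun C hC => h C (by simp [hC])
    simp only [adList, List.foldr_cons] at ih ⊢
    rw [map_sub, map_mul, map_mul, ih, h B (by simp)]

theorem of_sub_of_mem_charKernel {A : Finset α} {P Q : SetCompOn A}
    (h : ∀ B, B ∈ P.1.blocks ↔ B ∈ Q.1.blocks) :
    MonoidAlgebra.of F _ P - MonoidAlgebra.of F _ Q ∈ charKernel F A := by
  rw [mem_charKernel]
  intro R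
  have : R.Refines P ↔ R.Refines Q := by simp only [SetCompOn.Refines, h]
  rw [map_sub, refineChar_of, refineChar_of]
  by_cases hP : R.Refines P
  · rw [if_pos hP, if_pos (this.1 hP), sub_self]
  · rw [if_neg hP, if_neg (mt this.2 hP), sub_self]

/-- Each bracket costs one radical factor: right multiplication by `(A \ B, B) - (B, A \ B)` fixes
the letters disjoint from `B` and turns the innermost letter `C ∪ B` into `[C, B]`. -/
theorem exists_radSeries_adList {A : Finset α} (L : List (Finset α)) (B : Finset α)
    (P : SetCompOn A) (hP : P.1.blocks = L ++ [B]) :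
    ∃ d ∈ radSeries (Alg F A) (Alg F A) L.length,
      toWord F (incl F A d) = adList F L (letter F B) := by
  induction L using List.reverseRecOn generalizing B P with
  | nil =>
    refine ⟨MonoidAlgebra.of F _ P, trivial, ?_⟩
    rw [incl_of, toWord_single, hP]
    rfl
  | append_singleton L C ih =>
    have hn := P.1.nonempty
    have hd := P.1.disjoint
    have hs := fun a => P.2 ▸ (SetComp.mem_support (P := P.1) (a := a))
    rw [hP] at hn hd hs
    simp only [List.append_assoc, List.cons_append, List.nil_append, List.pairwise_append,
      List.mem_append, List.mem_cons, List.not_mem_nil, or_false, List.pairwise_cons,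
      forall_eq, or_imp, forall_and, exists_or, or_and_right,
      exists_eq_left] at hn hd hs
    obtain ⟨hnL, hnC, hnB⟩ := hn
    obtain ⟨hdL, ⟨hCB, -⟩, hLC, hLB⟩ := hd
    -- Merging the last two blocks gives the composition to which the induction hypothesis applies.
    let P' : SetCompOn A := ⟨⟨L ++ [C ∪ B], by
        simp only [List.mem_append, List.mem_singleton, or_imp, forall_and, forall_eq]
        exact ⟨hnL, hnC.mono Finset.subset_union_left⟩, by
        simp only [List.pairwise_append, List.pairwise_singleton, List.mem_singleton, forall_eq,
          Finset.disjoint_union_right, true_and]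
        exact ⟨hdL, fun D hD => ⟨hLC D hD, hLB D hD⟩⟩⟩, by
        ext a
        rw [SetComp.mem_support, hs]
        simp [or_and_right, exists_or]⟩
    obtain ⟨d, hdm, hde⟩ := ih (C ∪ B) P' rfl
    have hBA : B ⊆ A := fun a ha => (hs a).2 (Or.inr (Or.inr ha))
    have hCA : C ⊆ A := fun a ha => (hs a).2 (Or.inr (Or.inl ha))
    have hLA : ∀ D ∈ L, D ⊆ A := fun D hD a ha => (hs a).2 (Or.inl ⟨D, hD, ha⟩)
    have hCX : C ⊆ A \ B := Finset.subset_sdiff.2 ⟨hCA, hCB⟩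
    let M₁ : SetCompOn A := ⟨⟨[A \ B, B], by simpa using ⟨hnC.mono hCX, hnB⟩, by
      simpa using Finset.sdiff_disjoint⟩, by
        ext a
        rw [SetComp.mem_support]
        simp only [List.mem_cons, List.not_mem_nil, or_false, exists_eq_or_imp, exists_eq_left,
          Finset.mem_sdiff]
        have := @hBA a
        tauto⟩
    let M₂ : SetCompOn A := ⟨⟨[B, A \ B], by simpa using ⟨hnB, hnC.mono hCX⟩, by
      simpa using Finset.disjoint_sdiff⟩, by
        ext a
        rw [SetComp.mem_support]
        simp only [List.mem_cons, List.not_mem_nil, or_false, exists_eq_or_imp, exists_eq_left,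
          Finset.mem_sdiff]
        have := @hBA a
        tauto⟩
    have hL : ∀ D ∈ L, D ∩ (A \ B) = D ∧ D ∩ B = ∅ := fun D hD =>
      ⟨Finset.inter_eq_left.2 (Finset.subset_sdiff.2 ⟨hLA D hD, hLB D hD⟩),
        Finset.disjoint_iff_inter_eq_empty.1 (hLB D hD)⟩
    have hC1 : (C ∪ B) ∩ (A \ B) = C := by
      ext a
      have h1 := @hCX a
      simp only [Finset.mem_inter, Finset.mem_union, Finset.mem_sdiff] at h1 ⊢
      tauto
    have hB1 : (C ∪ B) ∩ B = B := Finset.inter_eq_right.2 Finset.subset_union_right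
    have hA : A.Nonempty := hnB.mono hBA
    refine ⟨d * (MonoidAlgebra.of F _ M₁ - MonoidAlgebra.of F _ M₂), ?_, ?_⟩
    · rw [List.length_append]
      refine mul_mem_radSeries_succ _ hdm ?_
      rw [jacobson_eq_charKernel hA]
      exact of_sub_of_mem_charKernel fun D => by simp [M₁, M₂, or_comm]
    · rw [mul_sub, map_sub, map_sub, toWord_incl_mul, toWord_incl_mul, hde,
        map_adList _ L _ fun D hD => ?_, map_adList _ L _ fun D hD => ?_, ← adList_sub,
        refineHom_letter, refineHom_letter]
      · have e1 : (M₁.1.blocks.map fun D => (C ∪ B) ∩ D).filter (fun B => B.Nonempty)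
            = [C, B] := by
          simp [M₁, hC1, hB1, hnC, hnB]
        have e2 : (M₂.1.blocks.map fun D => (C ∪ B) ∩ D).filter (fun B => B.Nonempty)
            = [B, C] := by
          simp [M₂, hC1, hB1, hnC, hnB]
        rw [e1, e2, adList, adList, List.foldr_append]
        congr 1
        simp only [List.foldr_cons, List.foldr_nil, letter, ← map_mul]
        rfl
      · rw [refineHom_letter]
        simp [M₂, hL D hD, hnL D hD, letter]
      · rw [refineHom_letter]
        simp [M₁, hL D hD, hnL D hD, letter]

end FreeAlgebra

/-! ### Dynkin elements as nested commutators -/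

section Dynkin

variable {F : Type*} [Field F] {α : Type*} [LinearOrder α]

variable (F) in
/-- The span of the set compositions of `E` in `FΠ`. -/
noncomputable def supportSpan (E : Finset α) : Submodule F (FreeTwisted F α) :=
  Submodule.span F ((fun P => Finsupp.single P 1) '' {P | P.support = E})

theorem single_mem_supportSpan {P : SetComp α} {E : Finset α} (h : P.support = E) :
    Finsupp.single P 1 ∈ supportSpan F E := Submodule.subset_span ⟨P, h, rfl⟩

theorem vee_single_single {P Q : SetComp α} (h : Disjoint P.support Q.support) :
    vee F (Finsupp.single P 1) (Finsupp.single Q 1) = Finsupp.single (P.concat Q h) 1 := by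
  simp [vee, h]

theorem support_concat {P Q : SetComp α} (h : Disjoint P.support Q.support) :
    (P.concat Q h).support = P.support ∪ Q.support := by
  ext a
  simp [SetComp.mem_support, SetComp.concat, or_and_right, exists_or]

/-- Concatenation is zero on overlapping supports, whereas the free product is not. The supports
must therefore be tracked for `toWord` to be multiplicative. -/
theorem vee_mem_supportSpan {E E' : Finset α} (h : Disjoint E E') {f g : FreeTwisted F α}
    (hf : f ∈ supportSpan F E) (hg : g ∈ supportSpan F E') :
    vee F f g ∈ supportSpan F (E ∪ E') ∧ toWord F (vee F f g) = toWord F f * toWord F g := by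
  induction hf using Submodule.span_induction with
  | mem f hf =>
    obtain ⟨P, rfl, rfl⟩ := hf
    induction hg using Submodule.span_induction with
    | mem g hg =>
      obtain ⟨Q, rfl, rfl⟩ := hg
      dsimp only
      rw [vee_single_single h]
      refine ⟨single_mem_supportSpan (support_concat h), ?_⟩
      rw [toWord_single, toWord_single, toWord_single, MonoidAlgebra.single_mul_single, mul_one]
      rfl
    | zero => simp
    | add x y _ _ hx hy =>
      rw [map_add, map_add, map_add, hx.2, hy.2, mul_add]
      exact ⟨add_mem hx.1 hy.1, rfl⟩
    | smul r x _ hx =>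
      rw [map_smul, map_smul, map_smul, hx.2, mul_smul_comm]
      exact ⟨Submodule.smul_mem _ r hx.1, rfl⟩
  | zero => simp
  | add x y _ _ hx hy =>
    rw [map_add, LinearMap.add_apply, map_add, map_add, hx.2, hy.2, add_mul]
    exact ⟨add_mem hx.1 hy.1, rfl⟩
  | smul r x _ hx =>
    rw [map_smul, LinearMap.smul_apply, map_smul, map_smul, hx.2, smul_mul_assoc]
    exact ⟨Submodule.smul_mem _ r hx.1, rfl⟩

theorem dynkinAux_cons (B : Finset α) (L : List (Finset α)) (hL : L ≠ [])
    (hn : ∀ C ∈ B :: L, C.Nonempty) (hd : (B :: L).Pairwise Disjoint) :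
    dynkinAux F (B :: L) hn hd = lie F
      (Finsupp.single ⟨[B], fun _ h => hn _ (by simp_all), List.pairwise_singleton _ _⟩ 1)
      (dynkinAux F L (fun D h => hn D (List.mem_cons_of_mem _ h)) hd.of_cons) := by
  cases L with
  | nil => exact absurd rfl hL
  | cons C L => rfl

theorem dynkinAux_append (L : List (Finset α)) (B : Finset α)
    (hn : ∀ C ∈ L ++ [B], C.Nonempty) (hd : (L ++ [B]).Pairwise Disjoint) :
    dynkinAux F (L ++ [B]) hn hd ∈ supportSpan F ((L ++ [B]).toFinset.biUnion id) ∧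
      toWord F (dynkinAux F (L ++ [B]) hn hd) = adList F L (letter F B) := by
  induction L with
  | nil =>
    simp only [List.nil_append, dynkinAux]
    refine ⟨single_mem_supportSpan rfl, ?_⟩
    rw [toWord_single]
    rfl
  | cons C L ih =>
    obtain ⟨ih1, ih2⟩ := ih (fun D h => hn D (List.mem_cons_of_mem _ h)) hd.of_cons
    simp only [List.cons_append] at hn hd ⊢
    rw [dynkinAux_cons _ _ (by simp), lie]
    have hC : Finsupp.single (⟨[C], fun _ h => hn _ (by simp_all),
        List.pairwise_singleton _ _⟩ : SetComp α) 1 ∈ supportSpan F C :=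
      single_mem_supportSpan (by simp [SetComp.support])
    have hdis : Disjoint C ((L ++ [B]).toFinset.biUnion id) := by
      rw [Finset.disjoint_biUnion_right]
      intro D hD
      exact (List.pairwise_cons.1 hd).1 D (List.mem_toFinset.1 hD)
    have h1 := vee_mem_supportSpan hdis hC ih1
    have h2 := vee_mem_supportSpan hdis.symm ih1 hC
    rw [Finset.union_comm] at h2
    rw [map_sub, h1.2, h2.2, ih2, toWord_single, List.toFinset_cons, Finset.biUnion_insert]
    exact ⟨sub_mem h1.1 h2.1, rfl⟩

theorem toWord_dynkin {P : SetComp α} {L : List (Finset α)} {B : Finset α}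
    (h : P.blocks = L ++ [B]) : toWord F (dynkin F P) = adList F L (letter F B) := by
  have : ∀ L' hn hd, L' = L ++ [B] →
      toWord F (dynkinAux F L' hn hd) = adList F L (letter F B) := by
    rintro _ hn hd rfl
    exact (dynkinAux_append L B hn hd).2
  exact this _ _ _ h

theorem exists_radSeries_dynkin {A : Finset α} (P : SetCompOn A) (hA : A.Nonempty) :
    ∃ d ∈ radSeries (Alg F A) (Alg F A) (P.len - 1), incl F A d = dynkin F P.1 := by
  have hne : P.1.blocks ≠ [] := List.ne_nil_of_length_pos (P.len_pos hA)
  obtain ⟨L, B, hLB⟩ : ∃ L B, P.1.blocks = L ++ [B] :=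
    ⟨_, _, (List.dropLast_append_getLast hne).symm⟩
  obtain ⟨d, hd, hde⟩ := exists_radSeries_adList (F := F) L B P hLB
  refine ⟨d, by simpa [SetCompOn.len, hLB] using hd, toWord_injective F ?_⟩
  rw [hde, toWord_dynkin hLB]

end Dynkin

/-! ### The split-or-merge involution -/

section Involution

variable {α : Type*} [LinearOrder α]

/-- Split the first block `B` that meets `T` into `B \ T` and `B ∩ T` or, if `B ⊆ T`, merge it
with the preceding block. -/
def splitMerge (T : Finset α) : List (Finset α) → List (Finset α)
  | [] => []
  | [B] => if (B ∩ T).Nonempty then [B \ T, B ∩ T] else [B]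
  | B :: C :: L =>
    if (B ∩ T).Nonempty then (B \ T) :: (B ∩ T) :: C :: L
    else if C ⊆ T then (B ∪ C) :: L
    else B :: splitMerge T (C :: L)

theorem splitMerge_of_nonempty {T B : Finset α} (L : List (Finset α)) (h : (B ∩ T).Nonempty) :
    splitMerge T (B :: L) = (B \ T) :: (B ∩ T) :: L := by
  cases L <;> rw [splitMerge, if_pos h]

theorem splitMerge_of_subset {T B C : Finset α} (L : List (Finset α)) (h : B ∩ T = ∅)
    (hC : C ⊆ T) : splitMerge T (B :: C :: L) = (B ∪ C) :: L := by
  rw [splitMerge, if_neg (by simp [h]), if_pos hC]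

theorem splitMerge_of_not_subset {T B C : Finset α} (L : List (Finset α)) (h : B ∩ T = ∅)
    (hC : ¬ C ⊆ T) : splitMerge T (B :: C :: L) = B :: splitMerge T (C :: L) := by
  rw [splitMerge, if_neg (by simp [h]), if_neg hC]

omit [LinearOrder α] in
theorem pairwise_disjoint_cons_iff {B : Finset α} {L : List (Finset α)} :
    (B :: L).Pairwise Disjoint ↔
      (∀ a ∈ B, ¬ ∃ C ∈ L, a ∈ C) ∧ L.Pairwise Disjoint := by
  rw [List.pairwise_cons]
  refine and_congr_left fun _ => ⟨fun h a ha ⟨C, hC, haC⟩ => ?_, fun h C hC => ?_⟩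
  · exact Finset.disjoint_left.1 (h C hC) ha haC
  · exact Finset.disjoint_left.2 fun a ha haC => h a ha ⟨C, hC, haC⟩

/-- Splitting leaves a block disjoint from `T` followed by one inside `T`, which is exactly the
pattern that gets merged. The traces on `T` and on its complement keep their order throughout. That
the first block is not inside `T` guarantees a preceding block to merge with. -/
theorem splitMerge_spec (T B : Finset α) (L : List (Finset α)) (hB : (B \ T).Nonempty)
    (hn : ∀ C ∈ B :: L, C.Nonempty) (hd : (B :: L).Pairwise Disjoint)
    (hT : ∃ C ∈ B :: L, (C ∩ T).Nonempty) :
    (∀ C ∈ splitMerge T (B :: L), C.Nonempty) ∧ (splitMerge T (B :: L)).Pairwise Disjoint ∧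
    (∀ a, (∃ C ∈ splitMerge T (B :: L), a ∈ C) ↔ ∃ C ∈ B :: L, a ∈ C) ∧
    (∃ C N, splitMerge T (B :: L) = C :: N ∧ B \ T ⊆ C) ∧
    ((splitMerge T (B :: L)).length = L.length + 2 ∨ (splitMerge T (B :: L)).length = L.length) ∧
    splitMerge T (splitMerge T (B :: L)) = B :: L ∧
    ((splitMerge T (B :: L)).map (· \ T)).filter (fun C => C.Nonempty) =
      ((B :: L).map (· \ T)).filter (fun C => C.Nonempty) ∧
    ((splitMerge T (B :: L)).map (T ∩ ·)).filter (fun C => C.Nonempty) =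
      ((B :: L).map (T ∩ ·)).filter (fun C => C.Nonempty) := by
  induction L generalizing B with
  | nil =>
    have h : (B ∩ T).Nonempty := by simpa using hT
    rw [splitMerge_of_nonempty _ h]
    have h1 : (B \ T) ∩ T = ∅ := by ext; simp
    have h2 : (B ∩ T) \ T = ∅ := by ext; simp
    have h3 : T ∩ (B \ T) = ∅ := by ext; simp
    have h4 : T ∩ (B ∩ T) = T ∩ B := by ext; simp +contextual
    have h5 : (T ∩ B).Nonempty := by rwa [Finset.inter_comm]
    rw [splitMerge_of_subset _ h1 Finset.inter_subset_right]
    refine ⟨by simp [hB, h], ?_, ?_, ⟨_, _, rfl, subset_rfl⟩, by simp,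
      by rw [Finset.sdiff_union_inter], by simp [h2, hB], by simp [h3, h4, h5]⟩
    · simpa using Finset.disjoint_sdiff_inter B T
    · intro a
      simp only [List.mem_cons, List.not_mem_nil, or_false, exists_eq_or_imp, exists_eq_left,
        Finset.mem_sdiff, Finset.mem_inter]
      tauto
  | cons D L ih =>
    rw [pairwise_disjoint_cons_iff] at hd
    simp only [List.mem_cons, exists_eq_or_imp, forall_eq_or_imp, not_or] at hn hd hT
    obtain ⟨hBn, hDn, hLn⟩ := hn
    obtain ⟨hBd, hd⟩ := hd
    by_cases h : (B ∩ T).Nonempty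
    · rw [splitMerge_of_nonempty _ h]
      have h1 : (B \ T) ∩ T = ∅ := by ext; simp
      have h2 : (B ∩ T) \ T = ∅ := by ext; simp
      have h3 : T ∩ (B \ T) = ∅ := by ext; simp
      have h4 : T ∩ (B ∩ T) = T ∩ B := by ext; simp +contextual
      have h5 : (T ∩ B).Nonempty := by rwa [Finset.inter_comm]
      rw [splitMerge_of_subset _ h1 Finset.inter_subset_right]
      refine ⟨by simpa [hB, h, hDn] using hLn, ?_, ?_, ⟨_, _, rfl, subset_rfl⟩, by simp,
        by rw [Finset.sdiff_union_inter], by simp [h2, hB], by simp [h3, h4, h5]⟩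
      · simp only [pairwise_disjoint_cons_iff (B := B \ T), pairwise_disjoint_cons_iff (B := B ∩ T),
          List.mem_cons, exists_eq_or_imp, Finset.mem_sdiff, Finset.mem_inter]
        refine ⟨fun a ha => ?_, fun a ha => ?_, hd⟩
        · rintro (h | h | h)
          exacts [ha.2 h.2, (hBd a ha.1).1 h, (hBd a ha.1).2 h]
        · rintro (h | h)
          exacts [(hBd a ha.1).1 h, (hBd a ha.1).2 h]
      · intro a
        simp only [List.mem_cons, exists_eq_or_imp, Finset.mem_sdiff, Finset.mem_inter]
        tauto
    · have h0 : B ∩ T = ∅ := Finset.not_nonempty_iff_eq_empty.1 h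
      have hBT : B \ T = B :=
        Finset.sdiff_eq_self_iff_disjoint.2 (Finset.disjoint_iff_inter_eq_empty.2 h0)
      by_cases hD : D ⊆ T
      · rw [splitMerge_of_subset _ h0 hD]
        have h1 : (B ∪ D) ∩ T = D := by
          rw [Finset.union_inter_distrib_right, h0, Finset.empty_union, Finset.inter_eq_left.2 hD]
        have h2 : (B ∪ D) \ T = B := by
          rw [Finset.union_sdiff_distrib, hBT, Finset.sdiff_eq_empty_iff_subset.2 hD,
            Finset.union_empty]
        have h3 : T ∩ (B ∪ D) = D := by rw [Finset.inter_comm, h1]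
        have h4 : T ∩ B = ∅ := by rw [Finset.inter_comm, h0]
        have h5 : T ∩ D = D := Finset.inter_eq_right.2 hD
        rw [splitMerge_of_nonempty _ (by rwa [h1]), h1, h2]
        refine ⟨by simpa [hBn] using hLn, ?_, ?_, ⟨_, _, rfl, ?_⟩, by simp, rfl, ?_, ?_⟩
        · simp only [pairwise_disjoint_cons_iff, Finset.mem_union] at hd ⊢
          exact ⟨fun a ha => ha.elim (fun h => (hBd a h).2) (hd.1 a), hd.2⟩
        · intro a
          simp only [List.mem_cons, exists_eq_or_imp, Finset.mem_union]
          tauto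
        · rw [hBT]; exact Finset.subset_union_left
        · simp [h2, hBT, Finset.sdiff_eq_empty_iff_subset.2 hD, List.filter_cons]
        · simp [h3, h4, h5]
      · rw [splitMerge_of_not_subset _ h0 hD]
        obtain ⟨i1, i2, i3, ⟨C, N, i4, i4'⟩, i5, i6, i7, i8⟩ := ih D
          (Finset.sdiff_nonempty.2 hD) (by simpa [hDn] using hLn) hd (by
            simpa [h] using hT)
        -- The new head is not inside `T` either, so a second application takes the same recursive
        -- branch.
        have hC : ¬ C ⊆ T := by
          rw [← Finset.sdiff_nonempty]
          refine (Finset.sdiff_nonempty.2 hD).mono fun a ha => ?_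
          exact Finset.mem_sdiff.2 ⟨i4' ha, (Finset.mem_sdiff.1 ha).2⟩
        refine ⟨?_, ?_, ?_, ⟨_, _, rfl, Finset.sdiff_subset⟩, ?_, ?_, ?_, ?_⟩
        · simp only [List.mem_cons, forall_eq_or_imp]
          exact ⟨hBn, i1⟩
        · rw [pairwise_disjoint_cons_iff]
          refine ⟨fun a ha => ?_, i2⟩
          rw [i3]
          simpa using hBd a ha
        · intro a
          simp only [List.mem_cons, exists_eq_or_imp] at i3 ⊢
          rw [i3]
        · simp only [List.length_cons]
          omega
        · rw [i4, splitMerge_of_not_subset _ h0 hC, ← i4, i6]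
        · rw [List.map_cons, List.filter_cons, i7, List.map_cons (a := B),
            List.filter_cons (xs := List.map _ (D :: L))]
        · rw [List.map_cons, List.filter_cons, i8, List.map_cons (a := B),
            List.filter_cons (xs := List.map _ (D :: L))]

end Involution

/-! ### Two-block compositions annihilate `e_A` -/

section Idempotent

variable (F : Type*) [Field F] {α : Type*} [LinearOrder α] (A : Finset α)

open Classical in
/-- The element `e_A` of `FΠ_A`. -/
noncomputable def eAlg : Alg F A :=
  ∑ P : SetCompOn A with P.MinInHead, (-1 : F) ^ (P.len - 1) • MonoidAlgebra.of F _ P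

theorem incl_eAlg : incl F A (eAlg F A) = eSet F A := by
  simp only [eAlg, eSet, map_sum, map_smul, incl_of]
  rfl

variable {F A}

theorem blocks_two_mul {T : Finset α} {M : SetCompOn A} (hM : M.1.blocks = [A \ T, T])
    (Q : SetCompOn A) : (M * Q).1.blocks =
      (Q.1.blocks.map (· \ T)).filter (fun C => C.Nonempty) ++
        (Q.1.blocks.map (T ∩ ·)).filter (fun C => C.Nonempty) := by
  rw [blocks_mul_eq_flatMap, hM]
  simp only [List.flatMap_cons, List.flatMap_nil, List.append_nil]
  congr 2
  refine List.map_congr_left fun C hC => ?_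
  rw [Finset.sdiff_inter_right_comm, Finset.inter_eq_right.2 (Q.block_subset hC)]

/-- The product `M * Q` depends only on the ordered traces of `Q` on `A \ T` and `T`. The involution
preserves these, keeps `min A` in the first block since `min A ∉ T`, and changes the length by one,
so the signed terms cancel in pairs. -/
theorem of_mul_eAlg {T : Finset α} {M : SetCompOn A} (hM : M.1.blocks = [A \ T, T]) {a : α}
    (ha : IsLeast (A : Set α) a) (haT : a ∉ T) : MonoidAlgebra.of F _ M * eAlg F A = 0 := by
  classical
  have hTn : T.Nonempty := M.1.nonempty T (by simp [hM])
  have hTA : T ⊆ A := M.block_subset (by simp [hM])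
  have key : ∀ Q : SetCompOn A, Q.MinInHead → ∃ Q' : SetCompOn A, Q'.MinInHead ∧
      Q'.1.blocks = splitMerge T Q.1.blocks ∧ splitMerge T Q'.1.blocks = Q.1.blocks ∧
      M * Q' = M * Q ∧ (Q'.len = Q.len + 1 ∨ Q'.len + 1 = Q.len) ∧ 1 ≤ Q.len ∧ 1 ≤ Q'.len := by
    rintro Q ⟨B, hB, b, hb, hbA⟩
    obtain rfl := ha.unique hbA
    obtain ⟨L, hL⟩ : ∃ L, Q.1.blocks = B :: L := by
      cases h : Q.1.blocks with
      | nil => simp [h] at hB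
      | cons C L => simp only [h, List.head?_cons, Option.mem_def, Option.some.injEq] at hB
                    exact ⟨L, by rw [hB]⟩
    have hBT : a ∈ B \ T := Finset.mem_sdiff.2 ⟨hb, haT⟩
    have hT : ∃ C ∈ B :: L, (C ∩ T).Nonempty := by
      obtain ⟨t, ht⟩ := hTn
      obtain ⟨C, hC, htC⟩ := Q.exists_mem_block (hTA ht)
      exact ⟨C, hL ▸ hC, t, Finset.mem_inter.2 ⟨htC, ht⟩⟩
    obtain ⟨i1, i2, i3, ⟨C, N, i4, i4'⟩, i5, i6, i7, i8⟩ := splitMerge_spec T B L ⟨a, hBT⟩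
      (hL ▸ Q.1.nonempty) (hL ▸ Q.1.disjoint) hT
    rw [← hL] at i1 i2 i3 i4 i5 i6 i7 i8
    obtain ⟨Q', hQ'⟩ : ∃ Q' : SetCompOn A, Q'.1.blocks = splitMerge T Q.1.blocks := by
      refine ⟨⟨⟨_, i1, i2⟩, ?_⟩, rfl⟩
      ext x
      rw [SetComp.mem_support, i3, ← SetComp.mem_support, Q.2]
    rw [← hQ'] at i4 i5 i6 i7 i8
    refine ⟨Q', ⟨C, by simp [i4], a, i4' hBT, ha⟩, hQ', i6, ?_, ?_, ?_, ?_⟩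
    · apply SetCompOn.ext_blocks
      rw [blocks_two_mul hM, blocks_two_mul hM, i7, i8]
    · simp only [SetCompOn.len]
      rw [hL, List.length_cons]
      omega
    · exact Q.len_pos ⟨a, ha.1⟩
    · exact SetCompOn.len_pos ⟨a, ha.1⟩ _
  choose g g1 g2 g3 g4 g5 g6 g7 using key
  rw [eAlg, Finset.mul_sum]
  refine Finset.sum_involution (fun Q hQ => g Q (Finset.mem_filter.1 hQ).2) ?_ ?_ ?_ ?_
  · intro Q hQ
    have hQ := (Finset.mem_filter.1 hQ).2
    have h5 := g5 Q hQ
    have h6 := g6 Q hQ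
    have h7 := g7 Q hQ
    simp only [mul_smul_comm, ← map_mul, g4 Q hQ]
    rw [← add_smul]
    obtain h | h := h5
    · rw [show (g Q hQ).len - 1 = Q.len - 1 + 1 by omega, pow_succ]
      simp
    · rw [show Q.len - 1 = (g Q hQ).len - 1 + 1 by omega, pow_succ]
      simp
  · intro Q hQ _ h
    have h5 := g5 Q (Finset.mem_filter.1 hQ).2
    rw [h] at h5
    omega
  · intro Q hQ
    exact Finset.mem_filter.2 ⟨Finset.mem_univ _, g1 _ _⟩
  · intro Q hQ
    apply SetCompOn.ext_blocks
    rw [g2, g3]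

end Idempotent

/-! ### Shuffle relations -/

section Shuffle

variable {F : Type*} [Field F] {α : Type*} [LinearOrder α] {A : Finset α}

open Classical in
theorem coeff_of_mul (M : SetCompOn A) (y : Alg F A) (P : SetCompOn A) :
    (MonoidAlgebra.of F _ M * y).coeff P = ∑ Q, if M * Q = P then y.coeff Q else 0 := by
  induction y using MonoidAlgebra.induction_on with
  | of Q =>
    rw [← map_mul, MonoidAlgebra.of_apply, MonoidAlgebra.of_apply, MonoidAlgebra.coeff_single,
      MonoidAlgebra.coeff_single, Finset.sum_eq_single Q]
    · simp [Finsupp.single_apply]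
    · intro R _ hR
      simp [hR.symm]
    · simp
  | add x y hx hy =>
    rw [mul_add, MonoidAlgebra.coeff_add, Finsupp.add_apply, hx, hy, ← Finset.sum_add_distrib]
    refine Finset.sum_congr rfl fun Q _ => ?_
    split_ifs <;> simp
  | smul r x hx =>
    rw [mul_smul_comm, MonoidAlgebra.coeff_smul_apply, hx, Finset.smul_sum]
    refine Finset.sum_congr rfl fun Q _ => ?_
    split_ifs <;> simp

theorem filter_inter_singletons (S : Finset α) (l : List α) :
    ((l.map fun a => ({a} : Finset α)).map (S ∩ ·)).filter (fun C => C.Nonempty) =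
      (l.filter (· ∈ S)).map fun a => {a} := by
  induction l with
  | nil => rfl
  | cons a l ih =>
    rw [List.map_cons, List.map_cons, List.filter_cons, ih, List.filter_cons]
    by_cases h : a ∈ S
    · simp [h]
    · simp [h]

theorem filter_sdiff_singletons (T : Finset α) (l : List α) :
    ((l.map fun a => ({a} : Finset α)).map (· \ T)).filter (fun C => C.Nonempty) =
      (l.filter (· ∉ T)).map fun a => {a} := by
  induction l with
  | nil => rfl
  | cons a l ih =>
    rw [List.map_cons, List.map_cons, List.filter_cons, ih, List.filter_cons]
    by_cases h : a ∈ T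
    · simp [h]
    · simp [h, Finset.sdiff_eq_self_of_disjoint]

-- In a shuffle of `u ++ [a]` with `v`, only letters of `v` can follow `a`. All of them do only in
-- the unshuffled word.
omit [LinearOrder α] in
theorem eq_or_shorter_of_filter {p : α → Bool} {l u v : List α} {a : α} (hl : l.Nodup)
    (h1 : l.filter (fun x => !p x) = u ++ [a]) (h2 : l.filter p = v) :
    l = u ++ a :: v ∨ ∃ u' v', l = u' ++ a :: v' ∧ v'.length < v.length := by
  have ha : a ∈ l.filter (fun x => !p x) := by rw [h1]; simp
  obtain ⟨hal, hpa⟩ := List.mem_filter.1 ha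
  simp only [Bool.not_eq_true'] at hpa
  obtain ⟨u', v', rfl⟩ := List.append_of_mem hal
  rw [List.filter_append, List.filter_cons, if_pos (by simp [hpa])] at h1
  rw [List.filter_append, List.filter_cons, if_neg (by simp [hpa])] at h2
  rw [List.nodup_append, List.nodup_cons] at hl
  obtain ⟨h3, -, h4⟩ := (List.append_cons_inj_of_notMem
    (fun h => hl.2.2 a (List.mem_filter.1 h).1 a (by simp) rfl)
    (fun h => hl.2.1.1 (List.mem_filter.1 h).1)).1 h1
  have hv : v'.filter p = v' := by
    rw [List.filter_eq_self]
    simpa using List.filter_eq_nil_iff.1 h4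
  rw [hv] at h2
  by_cases hu : u'.filter p = []
  · left
    have : u'.filter (fun x => !p x) = u' := by
      rw [List.filter_eq_self]
      simpa using List.filter_eq_nil_iff.1 hu
    rw [← h2, ← h3, hu, this, List.nil_append]
  · right
    refine ⟨u', v', rfl, ?_⟩
    rw [← h2, List.length_append]
    have := List.length_pos_iff.2 hu
    omega

theorem nodup_of_blocks {P : SetComp α} {l : List α} (h : P.blocks = l.map fun a => {a}) :
    l.Nodup :=
  List.Nodup.of_map _ (h ▸ nodup_blocks P)

theorem mem_iff_of_blocks {P : SetCompOn A} {l : List α} (h : P.1.blocks = l.map fun a => {a})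
    {x : α} : x ∈ l ↔ x ∈ A := by
  rw [← P.2, SetComp.mem_support, h]
  simp

/-- Strong induction on the number of letters after `a`. Taking `T` to be the set of these letters,
the relation at `u a v` sums the coefficients of all shuffles of `u a` with `v`; every term but `u a
v` itself has fewer letters after `a`. -/
theorem eq_zero_of_shuffle {a : α} {y : Alg F A} (hy : y ∈ longSpan F A A.card)
    (hM : ∀ (M : SetCompOn A) (T : Finset α), M.1.blocks = [A \ T, T] → a ∉ T →
      MonoidAlgebra.of F _ M * y = 0)
    (hend : ∀ (P : SetCompOn A) (l : List α), P.1.blocks = (l ++ [a]).map (fun x => {x}) →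
      y.coeff P = 0) (ha : a ∈ A) : y = 0 := by
  classical
  have key : ∀ m, ∀ (P : SetCompOn A) (u v : List α), v.length = m →
      P.1.blocks = (u ++ a :: v).map (fun x => {x}) → y.coeff P = 0 := by
    intro m
    induction m using Nat.strong_induction_on with
    | _ m ih =>
      intro P u v hv hP
      by_cases hv0 : v = []
      · subst hv0
        exact hend P u hP
      have hnd := nodup_of_blocks hP
      rw [List.nodup_append, List.nodup_cons] at hnd
      obtain ⟨hu, ⟨hav, hvn⟩, huv⟩ := hnd
      have hmem : ∀ x, x ∈ u ++ a :: v ↔ x ∈ A := fun x => mem_iff_of_blocks hP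
      have hvA : v.toFinset ⊆ A := fun x hx => (hmem x).1 (by simp [List.mem_toFinset.1 hx])
      have haT : a ∉ v.toFinset := by simpa using hav
      let M : SetCompOn A := ⟨⟨[A \ v.toFinset, v.toFinset], by
        simp only [List.mem_cons, List.not_mem_nil, or_false, forall_eq_or_imp, forall_eq]
        exact ⟨⟨a, Finset.mem_sdiff.2 ⟨ha, haT⟩⟩, by simpa using hv0⟩, by
        simpa using Finset.sdiff_disjoint⟩, by
          ext x
          rw [SetComp.mem_support]
          simp only [List.mem_cons, List.not_mem_nil, or_false, exists_eq_or_imp, exists_eq_left,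
            Finset.mem_sdiff]
          have := @hvA x
          tauto⟩
      have h := congrArg (fun z : Alg F A => z.coeff P) (hM M v.toFinset rfl haT)
      simp only [coeff_of_mul, MonoidAlgebra.coeff_zero, Finsupp.zero_apply] at h
      have hMP : M * P = P := by
        apply SetCompOn.ext_blocks
        rw [blocks_two_mul (T := v.toFinset) rfl, hP, filter_sdiff_singletons,
          filter_inter_singletons, ← List.map_append]
        congr 1
        have e1 : (u ++ a :: v).filter (fun x => x ∉ v.toFinset) = u ++ [a] := by
          rw [List.filter_append, List.filter_cons, if_pos (by simpa using hav),
            List.filter_eq_self.2, List.filter_eq_nil_iff.2]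
          · simp
          · intro x hx
            simpa using fun h => huv x hx x (by simp [h]) rfl
        have e2 : (u ++ a :: v).filter (fun x => x ∈ v.toFinset) = v := by
          rw [List.filter_append, List.filter_cons, if_neg (by simpa using hav),
            List.filter_eq_nil_iff.2, List.filter_eq_self.2]
          · simp
          · simp
          · intro x hx
            simpa using fun h => huv x hx x (by simp [h]) rfl
        rw [e1, e2]
        simp
      rw [Finset.sum_eq_single P, if_pos hMP] at h
      · exact h
      · intro Q _ hQP
        split_ifs with hMQ
        · by_cases hQ : Q.len < A.card
          · exact coeff_eq_zero_of_mem_longSpan hy hQ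
          obtain ⟨l, hl⟩ := Q.exists_singletons (not_lt.1 hQ)
          have h' := congrArg (fun R : SetCompOn A => R.1.blocks) (hMQ.trans hMP.symm)
          simp only [blocks_two_mul (T := v.toFinset) (M := M) rfl, hl] at h'
          rw [← blocks_two_mul (T := v.toFinset) (M := M) rfl, hMP, hP, filter_sdiff_singletons,
            filter_inter_singletons, ← List.map_append] at h'
          have h' := (List.map_injective_iff.2 Finset.singleton_injective) h'
          have hp : (l.filter (· ∈ v.toFinset)).length = v.length := by
            refine List.Perm.length_eq ?_
            rw [List.perm_ext_iff_of_nodup ((nodup_of_blocks hl).filter _) hvn]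
            intro x
            have := mem_iff_of_blocks hl (x := x)
            have := @hvA x
            simp only [List.mem_filter, List.mem_toFinset, decide_eq_true_eq] at *
            tauto
          rw [show u ++ a :: v = (u ++ [a]) ++ v by simp] at h'
          obtain ⟨h1, h2⟩ := List.append_inj' h' hp
          obtain h3 | ⟨u', v', rfl, h3⟩ := eq_or_shorter_of_filter (nodup_of_blocks hl)
            (by simpa using h1) h2
          · exact absurd (SetCompOn.ext_blocks (by rw [hl, hP, h3])) hQP
          · exact ih v'.length (hv ▸ h3) Q u' v' rfl hl
        · rfl
      · simp
  ext P
  by_cases hP : P.len < A.card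
  · exact coeff_eq_zero_of_mem_longSpan hy hP
  obtain ⟨l, hl⟩ := P.exists_singletons (not_lt.1 hP)
  obtain ⟨u, v, rfl⟩ := List.append_of_mem ((mem_iff_of_blocks hl).2 ha)
  exact key _ P u v rfl hl

end Shuffle

/-! ### Coefficients and products of words -/

section Words

variable {F : Type*} [Field F] {α : Type*} [LinearOrder α]

theorem coeff_toWord (f : FreeTwisted F α) (P : SetComp α) :
    (toWord F f).coeff (FreeMonoid.ofList P.blocks) = f P :=
  Finsupp.mapDomain_apply
    (fun _ _ h => SetComp.ext (FreeMonoid.ofList.injective h)) f P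

theorem incl_apply {A : Finset α} (f : Alg F A) (P : SetCompOn A) :
    incl F A f P.1 = f.coeff P :=
  Finsupp.mapDomain_apply Subtype.val_injective f.coeff P

-- Expanding the bracket, any term with a letter moved to the right ends in a letter of `L`, hence
-- not in `B`. Only the leading term `L ++ [B]` ends in `B`.
open Classical in
theorem coeff_adList {B : Finset α} (L L' : List (Finset α)) (hB : B ∉ L) :
    (adList F L (letter F B)).coeff (FreeMonoid.ofList (L' ++ [B])) = if L' = L then 1 else 0 := by
  induction L generalizing L' with
  | nil =>
    rw [adList, List.foldr_nil, letter, MonoidAlgebra.of_apply, MonoidAlgebra.coeff_single,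
      Finsupp.single_apply]
    refine if_congr ?_ rfl rfl
    rw [← FreeMonoid.ofList_singleton, FreeMonoid.ofList.injective.eq_iff]
    cases L' with
    | nil => simp
    | cons C L' => simp
  | cons C L ih =>
    simp only [List.mem_cons, not_or] at hB
    rw [adList, List.foldr_cons, ← adList, MonoidAlgebra.coeff_sub, Finsupp.sub_apply, letter,
      letter, MonoidAlgebra.of_apply, MonoidAlgebra.coeff_mul_single_of_forall_mul_ne, sub_zero]
    · cases L' with
      | nil =>
        rw [MonoidAlgebra.coeff_single_mul_of_forall_mul_ne, if_neg (by simp)]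
        intro d hd
        have h := congrArg FreeMonoid.toList hd
        simp only [FreeMonoid.toList_of_mul, FreeMonoid.toList_ofList, List.nil_append,
          List.cons.injEq] at h
        exact hB.1 h.1.symm
      | cons D L' =>
        by_cases hD : D = C
        · subst hD
          rw [MonoidAlgebra.coeff_single_mul_eq_mul_coeff (FreeMonoid.ofList (L' ++ [B])), one_mul]
          · refine (ih L' hB.2).trans ?_
            simp
          · intro d _
            rw [List.cons_append, FreeMonoid.ofList_cons]
            exact mul_right_inj _
        · rw [MonoidAlgebra.coeff_single_mul_of_forall_mul_ne, if_neg (by simp [hD])]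
          intro d hd
          have h := congrArg FreeMonoid.toList hd
          simp only [FreeMonoid.toList_of_mul, FreeMonoid.toList_ofList, List.cons_append,
            List.cons.injEq] at h
          exact hD h.1.symm
    · intro d hd
      have h := congrArg FreeMonoid.toList hd
      simp only [FreeMonoid.toList_mul, FreeMonoid.toList_of, FreeMonoid.toList_ofList] at h
      have := (List.append_inj' h rfl).2
      simp only [List.cons.injEq, and_true] at this
      exact hB.1 this.symm

theorem exists_word {A : Finset α} {l : List α} (hl : l.Nodup) (hA : ∀ x, x ∈ l ↔ x ∈ A) :
    ∃ P : SetCompOn A, P.1.blocks = l.map fun x => {x} := by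
  refine ⟨⟨⟨_, by simp, ?_⟩, ?_⟩, rfl⟩
  · rw [List.pairwise_map]
    exact hl.imp fun h => by simpa using h
  · ext x
    rw [SetComp.mem_support]
    simp [hA]

theorem eSet_singleton (a : α) (P : SetComp α) (hP : P.blocks = [{a}]) :
    eSet F {a} = Finsupp.single P 1 := by
  classical
  let Q : SetCompOn ({a} : Finset α) := ⟨P, by ext; simp [SetComp.mem_support, hP]⟩
  have hu : ∀ R : SetCompOn ({a} : Finset α), R = Q := fun R =>
    (R.eq_one_of_len (by simpa using R.len_le_card)).trans
      (Q.eq_one_of_len (by simpa using Q.len_le_card)).symm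
  rw [eSet, Finset.sum_eq_single Q]
  · simp [Q, hP]
  · exact fun R _ h => absurd (hu R) h
  · intro h
    refine absurd (Finset.mem_filter.2 ⟨Finset.mem_univ _, {a}, ?_, a, by simp, ?_⟩) h
    · simp [Q, hP]
    · simp

theorem eComp_word {P : SetComp α} {l : List α} (hP : P.blocks = l.map fun x => {x}) :
    eComp F P = Finsupp.single P 1 := by
  rw [eComp, hP]
  induction l generalizing P with
  | nil =>
    rw [show P = emptyComp from SetComp.ext hP]
    rfl
  | cons a l ih =>
    rw [List.map_cons] at hP
    have hn := P.nonempty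
    have hd := P.disjoint
    rw [hP] at hn hd
    let P₁ : SetComp α := ⟨[{a}], by simp, List.pairwise_singleton _ _⟩
    let P₂ : SetComp α := ⟨l.map fun x => {x}, by simp, hd.of_cons⟩
    have hdis : Disjoint P₁.support P₂.support := by
      have h := (List.pairwise_cons.1 hd).1
      rw [Finset.disjoint_left]
      intro x hx hx'
      obtain ⟨B, hB, hxB⟩ := SetComp.mem_support.1 hx
      obtain ⟨C, hC, hxC⟩ := SetComp.mem_support.1 hx'
      rw [List.mem_singleton.1 hB] at hxB
      exact Finset.disjoint_left.1 (h C hC) hxB hxC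
    rw [List.map_cons, List.map_cons, List.foldr_cons, ih (P := P₂) rfl,
      eSet_singleton a P₁ rfl, vee_single_single hdis]
    congr 1
    exact SetComp.ext hP.symm

/-- A singleton has only one set composition, so `e_Q = Q` for words and `eLin` acts trivially on
the top layer. -/
theorem eLin_incl {A : Finset α} {x : Alg F A} (hx : x ∈ longSpan F A A.card) :
    eLin F (incl F A x) = incl F A x := by
  have : longSpan F A A.card ≤ LinearMap.eqLocus (eLin F ∘ₗ incl F A) (incl F A) := by
    refine longSpan_le fun P hP => ?_
    obtain ⟨l, hl⟩ := P.exists_singletons hP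
    rw [LinearMap.mem_eqLocus, LinearMap.comp_apply, incl_of, eLin,
      Finsupp.linearCombination_single, one_smul, eComp_word hl]
  exact this hx

theorem mul_word_mem_longSpan {A : Finset α} {P : SetCompOn A} (hP : A.card ≤ P.len)
    (x : Alg F A) : x * MonoidAlgebra.of F _ P ∈ longSpan F A A.card := by
  induction x using MonoidAlgebra.induction_on with
  | of Q =>
    rw [← map_mul]
    refine of_mem_longSpan ?_
    obtain ⟨l, hl⟩ := P.exists_singletons hP
    -- The blocks of `Q * P` have at most one element each, so there are at least `A.card` of them.
    rw [← (Q * P).card_eq_sum, SetCompOn.len]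
    conv_rhs => rw [← mul_one (Q * P).1.blocks.length]
    rw [← smul_eq_mul, ← List.length_map (f := Finset.card)]
    apply List.sum_le_card_nsmul
    intro i hi
    obtain ⟨B, hB, rfl⟩ := List.mem_map.1 hi
    obtain ⟨-, C, -, D, hD, rfl⟩ := mem_blocks_mul.1 hB
    rw [hl] at hD
    obtain ⟨d, -, rfl⟩ := List.mem_map.1 hD
    exact Finset.card_le_card Finset.inter_subset_right
  | add x y hx hy => rw [add_mul]; exact add_mem hx hy
  | smul r x hx => rw [smul_mul_assoc]; exact Submodule.smul_mem _ r hx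

/-- A word already has the maximal number of blocks and cannot be refined further. -/
theorem mul_of_eq_self {A : Finset α} (P : SetCompOn A) {x : Alg F A}
    (hx : x ∈ longSpan F A A.card) : x * MonoidAlgebra.of F _ P = x := by
  have : longSpan F A A.card ≤
      LinearMap.eqLocus (LinearMap.mulRight F (MonoidAlgebra.of F _ P)) LinearMap.id := by
    refine longSpan_le fun Q hQ => ?_
    rw [LinearMap.mem_eqLocus, LinearMap.mulRight_apply, ← map_mul, LinearMap.id_apply,
      (len_mul_facts Q P).2]
    exact le_antisymm ((Q * P).len_le_card.trans hQ) (len_mul_facts Q P).1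
  exact this hx

/-- The identity `(A)` is the only composition with one block, and it occurs in `e_A` with
coefficient 1. -/
theorem eAlg_sub_one_mem_longSpan {A : Finset α} (hA : A.Nonempty) :
    eAlg F A - 1 ∈ longSpan F A 2 := by
  classical
  have h1 : (1 : SetCompOn A) ∈ Finset.univ.filter fun P : SetCompOn A => P.MinInHead := by
    refine Finset.mem_filter.2 ⟨Finset.mem_univ _, A, ?_, A.min' hA, A.min'_mem hA,
      A.isLeast_min' hA⟩
    rw [blocks_one]
    simp [hA]
  have h2 : (1 : SetCompOn A).len = 1 := by
    rw [SetCompOn.len, blocks_one]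
    simp [hA]
  rw [eAlg, ← Finset.add_sum_erase _ _ h1, h2]
  simp only [Nat.sub_self, pow_zero, one_smul, map_one, add_sub_cancel_left]
  refine Submodule.sum_mem _ fun P hP => Submodule.smul_mem _ _ (of_mem_longSpan ?_)
  have := mt (P.eq_one_of_len) (Finset.mem_erase.1 hP).1
  omega

theorem mul_radSeries_eq_zero {A : Finset α} (hA : A.Nonempty) {z x : Alg F A}
    (hz : z ∈ longSpan F A 2) (hx : x ∈ radSeries (Alg F A) (Alg F A) (A.card - 1)) :
    z * x = 0 := by
  have h := mul_radSeries_mem_longSpan hA hz hx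
  have := hA.card_pos
  rwa [show 2 + (A.card - 1) = A.card + 1 by omega, longSpan_card_succ, Submodule.mem_bot] at h

theorem radSeries_card_sub_one_le {A : Finset α} (hA : A.Nonempty) {x : Alg F A}
    (hx : x ∈ radSeries (Alg F A) (Alg F A) (A.card - 1)) : x ∈ longSpan F A A.card := by
  have h := radSeries_mem_longSpan hA hx
  have := hA.card_pos
  rwa [show 1 + (A.card - 1) = A.card by omega] at h

theorem radAlg_antitone (A : Finset α) : Antitone (radAlg F A) := by
  refine antitone_nat_of_succ_le fun k => ?_
  have : radSeries (Alg F A) (Alg F A) (k + 1) ≤ radSeries (Alg F A) (Alg F A) k :=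
    Submodule.map_subtype_le _ _
  exact fun x hx => this hx

theorem radAlg_card {A : Finset α} (hA : A.Nonempty) : radAlg F A A.card = ⊥ := by
  refine eq_bot_iff.2 fun x hx => ?_
  have h := radSeries_mem_longSpan hA hx
  rwa [add_comm, longSpan_card_succ] at h

end Words

/-! ### The Dynkin basis of the last nonzero radical -/

section Basis

variable (F : Type*) [Field F] {α : Type*} [LinearOrder α]

/-- The words `l` such that `(l, a)` is an ordering of `A`. -/
abbrev EndWord (A : Finset α) (a : α) : Type _ :=
  {l : List α // l ∈ (A.erase a).toList.permutations.toFinset}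

theorem EndWord.facts {A : Finset α} {a : α} (ha : a ∈ A) (l : EndWord A a) :
    (l.1 ++ [a]).Nodup ∧ (∀ x, x ∈ l.1 ++ [a] ↔ x ∈ A) ∧ l.1.length = A.card - 1 := by
  have h := List.mem_permutations.1 (List.mem_toFinset.1 l.2)
  have hm : ∀ x, x ∈ l.1 ↔ x ≠ a ∧ x ∈ A := fun x => by rw [h.mem_iff]; simp
  refine ⟨?_, fun x => ?_, ?_⟩
  · rw [List.nodup_append]
    refine ⟨h.nodup_iff.2 (Finset.nodup_toList _), by simp, fun x hx y hy => ?_⟩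
    rw [List.mem_singleton.1 hy]
    exact ((hm x).1 hx).1
  · rw [List.mem_append, hm, List.mem_singleton]
    by_cases hx : x = a
    · simp [hx, ha]
    · simp [hx]
  · rw [h.length_eq, Finset.length_toList, Finset.card_erase_of_mem ha]

theorem card_endWord {A : Finset α} {a : α} (ha : a ∈ A) :
    Fintype.card (EndWord A a) = (A.card - 1).factorial := by
  rw [Fintype.card_coe, List.toFinset_card_of_nodup
    (List.nodup_permutations _ (Finset.nodup_toList _)), List.length_permutations,
    Finset.length_toList, Finset.card_erase_of_mem ha]

/-- The set composition `(l₁, …, l_{n-1}, a)`. -/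
noncomputable def endComp {A : Finset α} {a : α} (ha : a ∈ A) (l : EndWord A a) : SetCompOn A :=
  (exists_word (l.facts ha).1 (l.facts ha).2.1).choose

theorem endComp_blocks {A : Finset α} {a : α} (ha : a ∈ A) (l : EndWord A a) :
    (endComp ha l).1.blocks = (l.1 ++ [a]).map fun x => {x} :=
  (exists_word (l.facts ha).1 (l.facts ha).2.1).choose_spec

theorem endComp_len {A : Finset α} {a : α} (ha : a ∈ A) (l : EndWord A a) :
    (endComp ha l).len = A.card := by
  have := Finset.card_pos.2 ⟨a, ha⟩
  rw [SetCompOn.len, endComp_blocks, List.length_map, List.length_append, (l.facts ha).2.2,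
    List.length_singleton]
  omega

theorem exists_endComp {A : Finset α} {a : α} (ha : a ∈ A) {P : SetCompOn A} {l : List α}
    (hP : P.1.blocks = (l ++ [a]).map fun x => {x}) : ∃ l', P = endComp ha l' ∧ l'.1 = l := by
  have hnd := nodup_of_blocks hP
  rw [List.nodup_append] at hnd
  refine ⟨⟨l, ?_⟩, SetCompOn.ext_blocks (by rw [hP, endComp_blocks]), rfl⟩
  rw [List.mem_toFinset, List.mem_permutations,
    List.perm_ext_iff_of_nodup hnd.1 (Finset.nodup_toList _)]
  intro x
  have := mem_iff_of_blocks hP (x := x)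
  rw [Finset.mem_toList, Finset.mem_erase, ← this, List.mem_append, List.mem_singleton]
  constructor
  · exact fun h => ⟨hnd.2.2 x h a (by simp), Or.inl h⟩
  · exact fun h => h.2.resolve_right h.1

theorem exists_dual_dynkin {A : Finset α} {a : α} (ha : a ∈ A) (l : EndWord A a) :
    ∃ d ∈ radSeries (Alg F A) (Alg F A) (A.card - 1), incl F A d = dynkin F (endComp ha l).1 ∧
      ∀ l', d.coeff (endComp ha l') = (Pi.single l 1 : EndWord A a → F) l' := by
  classical
  obtain ⟨d, hd, hde⟩ := exists_radSeries_dynkin (F := F) (endComp ha l) ⟨a, ha⟩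
  rw [endComp_len] at hd
  refine ⟨d, hd, hde, fun l' => ?_⟩
  rw [← incl_apply, ← coeff_toWord, hde, toWord_dynkin (L := l.1.map fun x => {x}) (B := {a})
    (by rw [endComp_blocks]; simp), endComp_blocks, List.map_append, List.map_singleton,
    coeff_adList, Pi.single_apply]
  · refine if_congr ?_ rfl rfl
    rw [(List.map_injective_iff.2 Finset.singleton_injective).eq_iff, Subtype.ext_iff]
  · have := (List.nodup_append.1 (l.facts ha).1).2.2
    simpa using fun h => this a h a (by simp) rfl

/-- Evaluation of an element of `FΠ_A` at the orderings of `A` that end with `a`. -/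
noncomputable def evalEnd {A : Finset α} {a : α} (ha : a ∈ A) :
    Alg F A →ₗ[F] (EndWord A a → F) :=
  LinearMap.pi fun l =>
    Finsupp.lapply (endComp ha l) ∘ₗ (MonoidAlgebra.coeffLinearEquiv F).toLinearMap

variable {F}

/-- Subtract the combination of Dynkin elements with the same coefficients at words ending in `a`.
The difference still satisfies the shuffle relations, so it vanishes. -/
theorem mem_span_dynkin {A : Finset α} {a : α} (ha : a ∈ A) {y : Alg F A}
    (hy : y ∈ longSpan F A A.card)
    (hM : ∀ (M : SetCompOn A) (T : Finset α), M.1.blocks = [A \ T, T] → a ∉ T →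
      MonoidAlgebra.of F _ M * y = 0) :
    y ∈ radAlg F A (A.card - 1) ∧
      incl F A y ∈ Submodule.span F (Set.range fun l => dynkin F (endComp ha l).1) := by
  classical
  choose d hd hde hdc using exists_dual_dynkin F ha
  have hsum : ∑ l, y.coeff (endComp ha l) • d l ∈ radAlg F A (A.card - 1) :=
    Submodule.sum_mem _ fun l _ => Submodule.smul_mem _ _ (hd l)
  have hA : A.Nonempty := ⟨a, ha⟩
  have hy' : y = ∑ l, y.coeff (endComp ha l) • d l := by
    rw [← sub_eq_zero]
    refine eq_zero_of_shuffle (a := a) (sub_mem hy (radSeries_card_sub_one_le hA hsum)) ?_ ?_ ha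
    · intro M T hMT haT
      rw [mul_sub, hM M T hMT haT, mul_radSeries_eq_zero hA (of_mem_longSpan ?_) hsum, sub_zero]
      rw [SetCompOn.len, hMT]
      rfl
    · intro P l hP
      obtain ⟨l', rfl, -⟩ := exists_endComp ha hP
      simp only [MonoidAlgebra.coeff_sub, Finsupp.sub_apply, MonoidAlgebra.coeff_sum,
        Finsupp.finsetSum_apply, MonoidAlgebra.coeff_smul_apply, hdc, Pi.single_apply]
      simp
  refine ⟨hy' ▸ hsum, ?_⟩
  rw [hy', map_sum]
  refine Submodule.sum_mem _ fun l _ => ?_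
  rw [map_smul, hde]
  exact Submodule.smul_mem _ _ (Submodule.subset_span ⟨l, rfl⟩)

theorem of_two_mul_eq_zero {A : Finset α} (hA : A.Nonempty) {y : Alg F A}
    (hy : y ∈ radAlg F A (A.card - 1)) {M : SetCompOn A} {T : Finset α}
    (hMT : M.1.blocks = [A \ T, T]) : MonoidAlgebra.of F _ M * y = 0 := by
  refine mul_radSeries_eq_zero hA (of_mem_longSpan ?_) hy
  rw [SetCompOn.len, hMT]
  rfl

/-- Evaluation at the words ending in a fixed letter is injective by the shuffle relations and
surjective by the dual Dynkin elements. -/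
theorem finrank_radAlg {A : Finset α} (hA : A.Nonempty) :
    Module.finrank F (radAlg F A (A.card - 1)) = (A.card - 1).factorial := by
  classical
  obtain ⟨a, ha⟩ := id hA
  choose d hd hde hdc using exists_dual_dynkin F ha
  let φ : radAlg F A (A.card - 1) →ₗ[F] (EndWord A a → F) :=
    evalEnd F ha ∘ₗ (radAlg F A (A.card - 1)).subtype
  have hφ : Function.Bijective φ := by
    constructor
    · rw [← LinearMap.ker_eq_bot, LinearMap.ker_eq_bot']
      rintro ⟨y, hy⟩ h
      rw [Submodule.mk_eq_zero]
      refine eq_zero_of_shuffle (a := a) (radSeries_card_sub_one_le hA hy)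
        (fun M T hMT _ => of_two_mul_eq_zero hA hy hMT) (fun P l hP => ?_) ha
      obtain ⟨l', rfl, -⟩ := exists_endComp ha hP
      exact congrFun h l'
    · rw [← LinearMap.range_eq_top, eq_top_iff, ← (Pi.basisFun F (EndWord A a)).span_eq,
        Submodule.span_le]
      rintro _ ⟨l, rfl⟩
      refine ⟨⟨d l, hd l⟩, ?_⟩
      ext l'
      rw [Pi.basisFun_apply]
      exact hdc l l'
  rw [(LinearEquiv.ofBijective φ hφ).finrank_eq, Module.finrank_fintype_fun_eq_card,
    card_endWord ha]

theorem map_incl_radAlg {A : Finset α} {a : α} (ha : a ∈ A) :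
    (radAlg F A (A.card - 1)).map (incl F A) =
      Submodule.span F (Set.range fun l => dynkin F (endComp ha l).1) := by
  have hA : A.Nonempty := ⟨a, ha⟩
  apply le_antisymm
  · rintro _ ⟨y, hy, rfl⟩
    exact (mem_span_dynkin ha (radSeries_card_sub_one_le hA hy)
      fun M T hMT _ => of_two_mul_eq_zero hA hy hMT).2
  · rw [Submodule.span_le]
    rintro _ ⟨l, rfl⟩
    obtain ⟨d, hd, hde, -⟩ := exists_dual_dynkin F ha l
    exact ⟨d, hd, hde⟩

theorem mem_radAlg_iff {A : Finset α} (hA : A.Nonempty) {P : SetCompOn A} (hP : A.card ≤ P.len)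
    {y : Alg F A} : y ∈ radAlg F A (A.card - 1) ↔
      ∃ f, y = eAlg F A * f * MonoidAlgebra.of F _ P := by
  constructor
  · intro hy
    refine ⟨y, ?_⟩
    have h := mul_radSeries_eq_zero hA (eAlg_sub_one_mem_longSpan hA) hy
    rw [sub_mul, one_mul, sub_eq_zero] at h
    -- The witness is `y` itself, fixed by `e_A` on the left and by the word `P` on the right.
    rw [h, mul_of_eq_self P (radSeries_card_sub_one_le hA hy)]
  · rintro ⟨f, rfl⟩
    refine (mem_span_dynkin (A.min'_mem hA) (mul_word_mem_longSpan hP _) ?_).1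
    intro M T hMT haT
    rw [← mul_assoc, ← mul_assoc, of_mul_eAlg hMT (A.isLeast_min' hA) haT, zero_mul, zero_mul]

end Basis

end SolomonTits

/-! ### The theorem for finite subsets of `ℕ+` -/

theorem corollary7p4 (F : Type*) [Field F] (n : ℕ) (hn : 0 < n)
    (a : Fin n → ℕ+) (ha : StrictMono a) (A : Finset ℕ+) (hA : A = Finset.univ.image a) :
    IsLeast {k : ℕ | radAlg F A k = ⊥} A.card ∧
    ((radAlg F A (n - 1)).map (incl F A) : Set (FreeTwisted F ℕ+)) =
      {y | ∃ f : Alg F A, y =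
        wedge F (wedge F (eSet F A) (incl F A f)) (eComp F (singletonComp a ha.injective))} ∧
    (radAlg F A (n - 1)).map (incl F A) =
      Submodule.span F {y | ∃ (x : Fin n → ℕ+) (hx : Function.Injective x),
        Finset.univ.image x = A ∧ x ⟨n - 1, Nat.sub_lt hn one_pos⟩ = a ⟨0, hn⟩ ∧
        y = eLin F (dynkin F (singletonComp x hx))} ∧
    Module.finrank F (radAlg F A (n - 1)) = (n - 1).factorial ∧
    radAlg F A n = ⊥ := by
  have hcard : A.card = n := by
    rw [hA, Finset.card_image_of_injective _ ha.injective, Finset.card_univ, Fintype.card_fin]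
  have haA : a ⟨0, hn⟩ ∈ A := by rw [hA]; simp
  have hne : A.Nonempty := ⟨_, haA⟩
  have hword : ∀ (x : Fin n → ℕ+) (hx : Function.Injective x),
      (singletonComp x hx).blocks = (List.ofFn x).map fun y => {y} := fun x hx => by
    rw [List.map_ofFn]
    rfl
  have hsupp : ∀ (x : Fin n → ℕ+) (hx : Function.Injective x), Finset.univ.image x = A →
      (singletonComp x hx).support = A := fun x hx hxA => by
    ext y
    rw [SetComp.mem_support, hword, ← hxA]
    simp [eq_comm]
  have hlen : ∀ (x : Fin n → ℕ+) (hx : Function.Injective x) (hxA : Finset.univ.image x = A),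
      SetCompOn.len (A := A) ⟨singletonComp x hx, hsupp x hx hxA⟩ = A.card := fun x hx hxA => by
    change (singletonComp x hx).blocks.length = _
    rw [hcard, hword]
    simp
  have hfr : Module.finrank F (radAlg F A (n - 1)) = (n - 1).factorial := by
    have := finrank_radAlg (F := F) hne
    rwa [hcard] at this
  have hbot : radAlg F A n = ⊥ := by
    have := radAlg_card (F := F) hne
    rwa [hcard] at this
  refine ⟨⟨?_, ?_⟩, ?_, ?_, hfr, hbot⟩
  · rw [hcard]
    exact hbot
  · intro k hk
    by_contra! h
    -- If an earlier term vanished, so would rad^(n-1), whose dimension is a factorial and hence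
    -- nonzero.
    have hle := radAlg_antitone (F := F) A (show k ≤ n - 1 by omega)
    rw [show radAlg F A k = ⊥ from hk, le_bot_iff] at hle
    rw [hle, finrank_bot] at hfr
    exact (Nat.factorial_pos _).ne hfr
  · let P : SetCompOn A := ⟨singletonComp a ha.injective, hsupp a ha.injective hA.symm⟩
    have hP : eComp F (singletonComp a ha.injective) = incl F A (MonoidAlgebra.of F _ P) := by
      rw [incl_of, eComp_word (hword a ha.injective)]
    ext y
    simp only [hP, ← incl_eAlg, wedge_incl, Set.mem_ofPred, SetLike.mem_coe, Submodule.mem_map]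
    rw [← hcard]
    simp only [mem_radAlg_iff hne (P := P) (hlen a ha.injective hA.symm).ge]
    constructor
    · rintro ⟨_, ⟨f, rfl⟩, rfl⟩
      exact ⟨f, rfl⟩
    · rintro ⟨f, rfl⟩
      exact ⟨_, ⟨f, rfl⟩, rfl⟩
  -- These Dynkin elements are combinations of words, so `eLin` can be dropped; it remains to match
  -- the injective maps `x` having last value `a ⟨0, hn⟩` with lists ending in that letter.
  · have hfix : ∀ (x : Fin n → ℕ+) (hx : Function.Injective x), Finset.univ.image x = A →
        eLin F (dynkin F (singletonComp x hx)) = dynkin F (singletonComp x hx) := by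
      intro x hx hxA
      obtain ⟨d, hd, hde⟩ := exists_radSeries_dynkin (F := F) (A := A)
        ⟨singletonComp x hx, hsupp x hx hxA⟩ hne
      rw [hlen x hx hxA] at hd
      dsimp only at hde
      rw [← hde, eLin_incl (radSeries_card_sub_one_le hne hd)]
    have hmap := map_incl_radAlg (F := F) haA
    rw [hcard] at hmap
    rw [hmap]
    congr 1
    ext y
    constructor
    · rintro ⟨l, rfl⟩
      obtain ⟨h1, h2, h3⟩ := l.facts haA
      have hl : (l.1 ++ [a ⟨0, hn⟩]).length = n := by
        rw [List.length_append, h3, hcard, List.length_singleton]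
        omega
      let x : Fin n → ℕ+ := fun i => (l.1 ++ [a ⟨0, hn⟩]).get (i.cast hl.symm)
      have hx : Function.Injective x := fun i j hij => by
        simpa using List.nodup_iff_injective_get.1 h1 hij
      have hofFn : List.ofFn x = l.1 ++ [a ⟨0, hn⟩] := by
        apply List.ext_get
        · simp [hl]
        · intro i h h'
          simp [x]
      have hxA : Finset.univ.image x = A := by
        ext z
        rw [← h2, ← hofFn, List.mem_ofFn]
        simp
      refine ⟨x, hx, hxA, ?_, ?_⟩
      · simp only [x, List.get_eq_getElem, Fin.val_cast]
        rw [List.getElem_append_right (by rw [h3, hcard])]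
        simp
      · rw [hfix x hx hxA]
        dsimp only
        congr 1
        apply SetComp.ext
        rw [endComp_blocks, hword, hofFn]
    · rintro ⟨x, hx, hxA, hlast, rfl⟩
      rw [hfix x hx hxA]
      have hne' : List.ofFn x ≠ [] := by
        rw [← List.length_pos_iff]
        simpa using hn
      have hget : (List.ofFn x).getLast hne' = a ⟨0, hn⟩ := by
        rw [List.getLast_eq_getElem]
        simpa using hlast
      have hx' : List.ofFn x = (List.ofFn x).dropLast ++ [a ⟨0, hn⟩] := by
        rw [← hget, List.dropLast_append_getLast]
      obtain ⟨l, hl, -⟩ := exists_endComp haA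
        (P := ⟨singletonComp x hx, hsupp x hx hxA⟩) (by rw [← hx']; exact hword x hx)
      exact ⟨l, by dsimp only; rw [← hl]⟩
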